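/- Write $\overline{(a_1,\dots,a_m)}=(-a_m,\dots,-a_1)$ for a finite sequence of signs $\pm1$. The only $0$-folding sequence is the empty one, and the $(n+1)$-folding sequences are the sequences $(\overline{W},\varepsilon,W)$ with $W$ an $n$-folding sequence and $\varepsilon\in\{+1,-1\}$ (these are the crease patterns of a strip of paper folded in two $n+1$ times). A sequence $S=(a_k)_{k\in\mathbb Z}\in\{+1,-1\}^{\mathbb Z}$ is a complete folding sequence if each of its finite subwords (finite blocks of consecutive terms) is a subword of an $n$-folding sequence for some $n$. Two sequences indexed by $\mathbb Z$ are locally isomorphic if they have the same finite subwords. Fix a real number $\alpha$ with $0<\alpha<1/4$. For $x,y\in\mathbb Z$ and $\zeta,\eta\in\{+1,-1\}$, let $C_H(x,y,\zeta,\eta)$ be the polygonal line with successive vertices $(x+\alpha,y+\zeta\alpha)$, $(x+2\alpha,y)$, $(x+1-2\alpha,y)$, $(x+1-\alpha,y+\eta\alpha)$, with support $[(x,y),(x+1,y)]$, and let $C_V(x,y,\zeta,\eta)$ be the polygonal line with successive vertices $(x+\zeta\alpha,y+\alpha)$, $(x,y+2\alpha)$, $(x,y+1-2\alpha)$, $(x+\eta\alpha,y+1-\alpha)$,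 with support $[(x,y),(x,y+1)]$. A segment is one of these polygonal lines together with one of its two orientations; its endpoints are the endpoints of its support. Two segments $(D,D')$ are consecutive if they have exactly one common point and the end of $D$ is the beginning of $D'$ (their supports then form a right angle). A complete curve is a family $C=(C_i)_{i\in\mathbb Z}$ of segments with pairwise distinct supports such that $(C_i,C_{i+1})$ is consecutive for each $i$. The sequence associated to $C$ is $(\eta_i)_{i\in\mathbb Z}$, where $\eta_i=+1$ (resp. $-1$) if one turns left (resp. right) when passing from $C_i$ to $C_{i+1}$. $C$ is a complete folding curve if its associated sequence is a complete folding sequence. A set $\mathcal E$ of segments is a covering of $\mathbb R^2$ if 1) each interval $[(x,y),(x+1,y)]$ or $[(x,y),(x,y+1)]$ with $x,y\in\mathbb Z$ is the support of a unique segment of $\mathcal E$; 2) if two distinct nonconsecutive segments of $\mathcal E$ have a common endpoint $X$, then they can be completed, within $\mathcal E$, into pairs of consecutive segments, with all four segments having distinct supports which contain $X$. **Theorem 3.7.** For each complete folding sequence $S$, there exists a complete folding curve $C=(C_i)_{i\in\mathbb Z}$ such that $\{C_i\mid i\in\mathbb Z\}$ is a covering of $\mathbb R^2$ and the sequence associated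 to $C$ is locally isomorphic to $S$. -/

import Mathlib

namespace Paperfolding

/-! ### Folding sequences

Signs `+1`, `-1` are elements of `ℤˣ`. -/

/-- The sequence `(-aₙ, …, -a₁)` obtained from `(a₁, …, aₙ)` by reversing the order and
changing the signs. -/
def bar (S : List ℤˣ) : List ℤˣ := (S.map (fun a => -a)).reverse

/-- `IsNFolding n S`: the list `S` is the sequence of creases (`+1` for `∨`, `-1` for `∧`, from
left to right) of a strip of paper folded `n` times in two, each time up or down.
The first of `n + 1` folds makes a crease `ε` in the middle and turns one half of the strip over
onto the other one. The next `n` folds act on both halves simultaneously: if they make the creases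
`S` on the right half, then they make the creases `bar S` on the left half, which lies upside
down and in the opposite direction. -/
inductive IsNFolding : ℕ → List ℤˣ → Prop
  | zero : IsNFolding 0 []
  | succ {n : ℕ} {S : List ℤˣ} (ε : ℤˣ) (h : IsNFolding n S) :
      IsNFolding (n + 1) (bar S ++ ε :: S)

/-- A finite folding sequence is a subword (block of consecutive terms) of an `n`-folding sequence
for some `n`. -/
def IsFiniteFolding (T : List ℤˣ) : Prop := ∃ n S, IsNFolding n S ∧ T <:+: S

/-- The finite list `T` is a subword of the biinfinite sequence `S`. -/
def IsSubword (T : List ℤˣ) (S : ℤ → ℤˣ) : Prop :=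
  ∃ h : ℤ, T = (List.range T.length).map (fun k : ℕ => S (h + (k : ℤ)))

/-- A complete folding sequence: all its finite subwords are finite folding sequences. -/
def IsCompleteFoldingSequence (S : ℤ → ℤˣ) : Prop :=
  ∀ T : List ℤˣ, IsSubword T S → IsFiniteFolding T

/-- Two biinfinite sequences are locally isomorphic if they have the same finite subwords. -/
def LocallyIsomorphic (S T : ℤ → ℤˣ) : Prop :=
  ∀ W : List ℤˣ, IsSubword W S ↔ IsSubword W T

/-! ### Segments of curves -/

/-- The direction of a unit interval of the square grid. -/
inductive Axis
  | horizontal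
  | vertical

/-- The unit intervals of the grid: `[(x, y), (x + 1, y)]` (horizontal) and
`[(x, y), (x, y + 1)]` (vertical), with `x, y ∈ ℤ`. -/
structure GridInterval where
  axis : Axis
  x : ℤ
  y : ℤ

/-- The left (resp. lower) endpoint of a unit interval. -/
def GridInterval.low (e : GridInterval) : ℤ × ℤ := (e.x, e.y)

/-- The right (resp. upper) endpoint of a unit interval. -/
def GridInterval.high (e : GridInterval) : ℤ × ℤ :=
  match e.axis with
  | .horizontal => (e.x + 1, e.y)
  | .vertical => (e.x, e.y + 1)

/-- The point of the plane with given integer coordinates. -/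
def toPlane (p : ℤ × ℤ) : ℝ × ℝ := ((p.1 : ℝ), (p.2 : ℝ))

/-- A unit interval, as a subset of the plane. -/
def GridInterval.toSet (e : GridInterval) : Set (ℝ × ℝ) :=
  segment ℝ (toPlane e.low) (toPlane e.high)

/-- Oriented segments of curves `C_H^±(x, y, ζ, η)` and `C_V^±(x, y, ζ, η)`: `orient = 1` means
from left to right (resp. from bottom to top), and `orient = -1` the opposite orientation. -/
structure CurveSegment extends GridInterval where
  ζ : ℤˣ
  η : ℤˣ
  orient : ℤˣ

namespace CurveSegment

/-- The support of a segment of curve. -/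
def support (s : CurveSegment) : Set (ℝ × ℝ) := s.toGridInterval.toSet

/-- The left (resp. lower) extremity of the bent curve. -/
def lowTip (α : ℝ) (s : CurveSegment) : ℝ × ℝ :=
  match s.axis with
  | .horizontal => (s.x + α, s.y + ((s.ζ : ℤ) : ℝ) * α)
  | .vertical => (s.x + ((s.ζ : ℤ) : ℝ) * α, s.y + α)

/-- The left (resp. lower) bend of the curve. -/
def lowBend (α : ℝ) (s : CurveSegment) : ℝ × ℝ :=
  match s.axis with
  | .horizontal => (s.x + 2 * α, s.y)
  | .vertical => (s.x, s.y + 2 * α)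

/-- The right (resp. upper) bend of the curve. -/
def highBend (α : ℝ) (s : CurveSegment) : ℝ × ℝ :=
  match s.axis with
  | .horizontal => (s.x + 1 - 2 * α, s.y)
  | .vertical => (s.x, s.y + 1 - 2 * α)

/-- The right (resp. upper) extremity of the bent curve. -/
def highTip (α : ℝ) (s : CurveSegment) : ℝ × ℝ :=
  match s.axis with
  | .horizontal => (s.x + 1 - α, s.y + ((s.η : ℤ) : ℝ) * α)
  | .vertical => (s.x + ((s.η : ℤ) : ℝ) * α, s.y + 1 - α)

/-- The segment of curve as a subset of the plane. It follows its support, except near the two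
endpoints of the support, where it is bent to one side. -/
def carrier (α : ℝ) (s : CurveSegment) : Set (ℝ × ℝ) :=
  segment ℝ (s.lowTip α) (s.lowBend α) ∪ segment ℝ (s.lowBend α) (s.highBend α) ∪
    segment ℝ (s.highBend α) (s.highTip α)

/-- The beginning of the oriented curve `s`. -/
def beginning (α : ℝ) (s : CurveSegment) : ℝ × ℝ :=
  if s.orient = 1 then s.lowTip α else s.highTip α

/-- The end of the oriented curve `s`. -/
def ending (α : ℝ) (s : CurveSegment) : ℝ × ℝ :=
  if s.orient = 1 then s.highTip α else s.lowTip α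

/-- The initial point: the endpoint of the support from which `s` is oriented. -/
def initialPoint (s : CurveSegment) : ℤ × ℤ :=
  if s.orient = 1 then s.low else s.high

/-- The terminal point: the endpoint of the support towards which `s` is oriented. -/
def terminalPoint (s : CurveSegment) : ℤ × ℤ :=
  if s.orient = 1 then s.high else s.low

/-- `X` is one of the two endpoints (of the support) of `s`. -/
def HasEndpoint (s : CurveSegment) (X : ℤ × ℤ) : Prop :=
  s.initialPoint = X ∨ s.terminalPoint = X

/-- The direction of the oriented segment, one of `(±1, 0)`, `(0, ±1)`. -/
def direction (s : CurveSegment) : ℤ × ℤ := s.terminalPoint - s.initialPoint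

/-- `(s, t)` is a pair of consecutive segments: `s` and `t` have exactly one common point, and
the end of `s` is the beginning of `t`. -/
def Consecutive (α : ℝ) (s t : CurveSegment) : Prop :=
  (∃ p, s.carrier α ∩ t.carrier α = {p}) ∧ s.ending α = t.beginning α

/-- `s` and `t`, in one of the two orders, are consecutive. -/
def Linked (α : ℝ) (s t : CurveSegment) : Prop :=
  Consecutive α s t ∨ Consecutive α t s

end CurveSegment

/-! ### Complete curves and coverings -/

/-- A complete curve: consecutive segments, indexed by `ℤ`, which all have distinct supports. -/
def IsCompleteCurve (α : ℝ) (C : ℤ → CurveSegment) : Prop :=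
  (∀ i, CurveSegment.Consecutive α (C i) (C (i + 1))) ∧
    ∀ i j, i ≠ j → (C i).support ≠ (C j).support

/-- The sequence associated to a curve: `S i = +1` (resp. `-1`) if one turns left (resp. right)
from `C i` to `C (i + 1)`, i.e. if the determinant of the two directions is `+1` (resp. `-1`). -/
def IsAssociated (C : ℤ → CurveSegment) (S : ℤ → ℤˣ) : Prop :=
  ∀ i, ((S i : ℤˣ) : ℤ) =
    (C i).direction.1 * (C (i + 1)).direction.2 - (C i).direction.2 * (C (i + 1)).direction.1

/-- A complete folding curve: a complete curve associated to a complete folding sequence. -/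
def IsCompleteFoldingCurve (α : ℝ) (C : ℤ → CurveSegment) : Prop :=
  IsCompleteCurve α C ∧ ∃ S, IsCompleteFoldingSequence S ∧ IsAssociated C S

/-- A set `E` of segments is a covering of the plane: each unit interval of the grid is the
support of a unique segment of `E`, and two distinct nonconsecutive segments of `E` with a common
endpoint `X` can be completed, inside `E`, into pairs of consecutive segments, with all four
segments having distinct supports which contain `X`. -/
def IsCoveringOfPlane (α : ℝ) (E : Set CurveSegment) : Prop :=
  (∀ e : GridInterval, ∃! s, s ∈ E ∧ s.support = e.toSet) ∧
    ∀ s ∈ E, ∀ t ∈ E, s ≠ t → ¬ CurveSegment.Linked α s t →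
      ∀ X : ℤ × ℤ, s.HasEndpoint X → t.HasEndpoint X →
        ∃ s' ∈ E, ∃ t' ∈ E, CurveSegment.Linked α s s' ∧ CurveSegment.Linked α t t' ∧
          [s.support, s'.support, t.support, t'.support].Nodup ∧
          toPlane X ∈ s.support ∧ toPlane X ∈ s'.support ∧
          toPlane X ∈ t.support ∧ toPlane X ∈ t'.support

end Paperfolding

/-! A folding word of level `n + 1` consists of a word of level `n`, a middle crease, and the word
of level `n` of the opposite type; the bit `p n` tells which type comes first. The finite subwords
that occur depend only on the bits `p`, and by compactness every complete folding sequence has the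
language of a single `p` (`exists_hasFoldLanguage`). It therefore suffices to run one curve through
all edges of the grid so that its turns have the language of this `p`.

Orient horizontal edges away from even points and vertical edges away from odd points. At each
vertex the two entering edges are then perpendicular to the two leaving ones, so a path along these
arcs makes a right-angle turn at every vertex. Multiply the grid by `1 + i` and replace each arc by
two legs of a right isosceles triangle: orientations match, old turns survive, and the new turn in
the middle records whether the old arc was horizontal or vertical. Hence the `n`-fold subdivision of
an arc spells a folding word (`descendant_step`); the quarter turn `rotV`, used or not at each
level, realises the bits `p`. Every fine arc is a child of exactly one coarse arc
(`child_bijective`), so the process can be read backwards from the whole grid: arcs with a common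
ancestor lie on one finite folding curve.

It remains to join all arcs into one curve. The free bits `q` decide at each level whether the half
turn `flipV` is applied; they do not affect turns. Whatever finitely many bits are fixed, later ones
can be chosen to give two prescribed arcs a common ancestor (`denselyMerging`). There are countably
many pairs, so Baire's theorem yields one `q` that merges all of them (`exists_forall_ancestor_eq`).
No point is then a vertex at all levels, so the curve has no end, and differences of indices number
the arcs by `ℤ` (`exists_enumeration`). Bending the arcs near the vertices gives the segments. -/

namespace Paperfolding

/-! ### Folding words in functional form -/

/-- The sign `+1` for `false` and `-1` for `true`. -/
def typeSign (s : Bool) : ℤˣ := if s then -1 else 1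

theorem typeSign_surjective (ε : ℤˣ) : ∃ s, typeSign s = ε := by
  rcases Int.units_eq_one_or ε with rfl | rfl
  · exact ⟨false, rfl⟩
  · exact ⟨true, rfl⟩

theorem typeSign_not (s : Bool) : typeSign (!s) = -typeSign s := by
  cases s <;> simp [typeSign]

/-- `foldTurn p n s k`, for `0 < k < 2 ^ n`, is the `k`-th crease of the `n`-folding sequence with
middle crease `typeSign s` whose successive foldings are prescribed by `p`. Replacing `s` by `!s`
replaces the sequence by its image under `bar`. -/
def foldTurn (p : ℕ → Bool) : ℕ → Bool → ℕ → ℤˣ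
  | 0, _, _ => 1
  | n + 1, s, k =>
    if k < 2 ^ n then foldTurn p n (p n) k
    else if k = 2 ^ n then typeSign s
    else foldTurn p n (!p n) (k - 2 ^ n)

theorem foldTurn_succ_lt (p : ℕ → Bool) {n : ℕ} (s : Bool) {k : ℕ} (h : k < 2 ^ n) :
    foldTurn p (n + 1) s k = foldTurn p n (p n) k := by
  simp [foldTurn, h]

theorem foldTurn_succ_mid (p : ℕ → Bool) (n : ℕ) (s : Bool) :
    foldTurn p (n + 1) s (2 ^ n) = typeSign s := by
  simp [foldTurn]

theorem foldTurn_succ_add (p : ℕ → Bool) (n : ℕ) (s : Bool) {k : ℕ} (h : 0 < k) :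
    foldTurn p (n + 1) s (2 ^ n + k) = foldTurn p n (!p n) k := by
  have h1 : ¬ (2 ^ n + k < 2 ^ n) := by omega
  have h2 : ¬ (2 ^ n + k = 2 ^ n) := by omega
  have h3 : 2 ^ n + k - 2 ^ n = k := by omega
  rw [foldTurn, if_neg h1, if_neg h2, h3]

theorem foldTurn_congr {p q : ℕ → Bool} {n : ℕ} (h : ∀ i < n, p i = q i) (s : Bool) (k : ℕ) :
    foldTurn p n s k = foldTurn q n s k := by
  induction n generalizing s k with
  | zero => rfl
  | succ n ih =>
    simp only [foldTurn, h n (Nat.lt_succ_self n), ih fun i hi => h i (by omega)]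

theorem foldTurn_not (p : ℕ → Bool) {n : ℕ} (s : Bool) {k : ℕ} (h0 : 0 < k) (h1 : k < 2 ^ n) :
    foldTurn p n (!s) (2 ^ n - k) = -foldTurn p n s k := by
  induction n generalizing s k with
  | zero => simp at h1; omega
  | succ n ih =>
    have e : 2 ^ (n + 1) = 2 ^ n + 2 ^ n := by ring
    rcases lt_trichotomy k (2 ^ n) with h | h | h
    · have e1 : 2 ^ (n + 1) - k = 2 ^ n + (2 ^ n - k) := by omega
      rw [e1, foldTurn_succ_add _ _ _ (by omega), foldTurn_succ_lt _ _ h, ih _ h0 h]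
    · subst h
      have e1 : 2 ^ (n + 1) - 2 ^ n = 2 ^ n := by omega
      rw [e1, foldTurn_succ_mid, foldTurn_succ_mid, typeSign_not]
    · obtain ⟨j, rfl⟩ := Nat.exists_eq_add_of_lt h
      have e1 : 2 ^ (n + 1) - (2 ^ n + j + 1) = 2 ^ n - (j + 1) := by omega
      rw [e1, add_assoc, foldTurn_succ_add _ _ _ (by omega), foldTurn_succ_lt _ _ (by omega),
        ← ih (!p n) (by omega) (by omega), Bool.not_not]

/-- At distance from the multiples of `2 ^ n`, a folding word is made of the folding words of
level `n` of alternating types. -/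
theorem foldTurn_block (p : ℕ → Bool) {n m : ℕ} (hm : n < m) (s : Bool) {b r : ℕ}
    (hr : 0 < r) (hr' : r < 2 ^ n) (hb : b * 2 ^ n + r < 2 ^ m) :
    foldTurn p m s (b * 2 ^ n + r) = foldTurn p n (xor (p n) (decide (b % 2 = 1))) r := by
  induction m, hm using Nat.le_induction generalizing s b with
  | base =>
    have hb2 : b < 2 := by
      by_contra hc
      have : 2 * 2 ^ n ≤ b * 2 ^ n := Nat.mul_le_mul_right _ (by omega)
      rw [pow_succ] at hb; omega
    interval_cases b
    · rw [zero_mul, zero_add, foldTurn_succ_lt _ _ hr']; simp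
    · rw [one_mul, foldTurn_succ_add _ _ _ hr]; simp
  | succ m hm ih =>
    obtain ⟨d, rfl⟩ := Nat.exists_eq_add_of_le hm
    rw [Nat.succ_eq_add_one] at *
    have e : 2 ^ (n + 1 + d) = 2 * 2 ^ d * 2 ^ n := by ring
    rcases lt_or_ge (b * 2 ^ n + r) (2 ^ (n + 1 + d)) with h | h
    · rw [foldTurn_succ_lt _ _ h, ih _ h]
    · have hb' : 2 * 2 ^ d ≤ b := by
        by_contra hc
        have : (b + 1) * 2 ^ n ≤ 2 * 2 ^ d * 2 ^ n := Nat.mul_le_mul_right _ (by omega)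
        rw [add_mul] at this; omega
      obtain ⟨c, rfl⟩ := Nat.exists_eq_add_of_le hb'
      have e1 : (2 * 2 ^ d + c) * 2 ^ n + r = 2 ^ (n + 1 + d) + (c * 2 ^ n + r) := by
        rw [e]; ring
      have e2 : 2 ^ (n + 1 + d + 1) = 2 ^ (n + 1 + d) + 2 ^ (n + 1 + d) := by ring
      rw [e1, foldTurn_succ_add _ _ _ (by omega), ih _ (by omega)]
      congr 4
      rw [Nat.mul_add_mod]

/-- In the words of level `n + 3`, the multiples of `2 ^ n` of a given parity carry both signs. -/
theorem exists_foldTurn_mul (p : ℕ → Bool) (n b : ℕ) (ε : ℤˣ) :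
    ∃ c, 0 < c ∧ c < 7 ∧ c % 2 = b % 2 ∧ foldTurn p (n + 3) false (c * 2 ^ n) = ε := by
  obtain ⟨s, rfl⟩ := typeSign_surjective ε
  have hpos : 0 < 2 ^ n := by positivity
  have e1 : 2 ^ (n + 1) = 2 * 2 ^ n := by ring
  have e2 : 2 ^ (n + 2) = 4 * 2 ^ n := by ring
  have e3 : 2 ^ (n + 3) = 8 * 2 ^ n := by ring
  rcases Nat.mod_two_eq_zero_or_one b with hb | hb <;> rw [hb]
  · by_cases h : p (n + 2) = s
    · refine ⟨2, by omega, by omega, by omega, ?_⟩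
      rw [← e1, foldTurn_succ_lt _ _ (by omega), foldTurn_succ_mid, h]
    · refine ⟨6, by omega, by omega, by omega, ?_⟩
      have : 6 * 2 ^ n = 2 ^ (n + 2) + 2 ^ (n + 1) := by omega
      rw [this, foldTurn_succ_add _ _ _ (by omega), foldTurn_succ_mid]
      congr 1; revert h; cases p (n + 2) <;> cases s <;> simp
  · have key : ∀ c, c < 4 → foldTurn p (n + 3) false (c * 2 ^ (n + 1) + 2 ^ n)
        = typeSign (xor (p (n + 1)) (decide (c % 2 = 1))) := fun c hc => by
      rw [foldTurn_block p (by omega) _ hpos (by omega) (by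
        have : c * 2 ^ (n + 1) ≤ 3 * 2 ^ (n + 1) := Nat.mul_le_mul_right _ (by omega)
        omega), foldTurn_succ_mid]
    by_cases h : p (n + 1) = s
    · refine ⟨1, by omega, by omega, by omega, ?_⟩
      have := key 0 (by omega)
      rw [zero_mul, zero_add] at this
      rw [one_mul, this, h]; simp
    · refine ⟨3, by omega, by omega, by omega, ?_⟩
      have := key 1 (by omega)
      rw [show 3 * 2 ^ n = 1 * 2 ^ (n + 1) + 2 ^ n by omega, this]
      congr 1; revert h; cases p (n + 1) <;> cases s <;> simp

/-- A short block of a folding word occurs in the word of level `n + 3`. -/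
theorem foldTurn_window (p : ℕ → Bool) {n m : ℕ} (hm : n + 3 ≤ m) (s : Bool) {a l : ℕ}
    (ha : 0 < a) (hl : l ≤ 2 ^ n) (hal : a + l ≤ 2 ^ m) :
    ∃ a', 0 < a' ∧ a' + l ≤ 2 ^ (n + 3) ∧
      ∀ i < l, foldTurn p m s (a + i) = foldTurn p (n + 3) false (a' + i) := by
  have hpos : 0 < 2 ^ n := by positivity
  have e3 : 2 ^ (n + 3) = 8 * 2 ^ n := by ring
  rcases Nat.eq_zero_or_pos l with rfl | hl0
  · exact ⟨1, by omega, by omega, by simp⟩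
  -- Divide the last position of the block: as `l ≤ 2 ^ n`, the only multiple of `2 ^ n` that can
  -- lie in the block is `b * 2 ^ n`. The block is moved so that this multiple goes to `c * 2 ^ n`,
  -- with the same crease there and the same parity, hence the same types on both sides.
  obtain ⟨b, r, hr, hbr⟩ : ∃ b r, r < 2 ^ n ∧ a + l - 1 = b * 2 ^ n + r :=
    ⟨(a + l - 1) / 2 ^ n, (a + l - 1) % 2 ^ n, Nat.mod_lt _ hpos, by
      rw [mul_comm]; exact (Nat.div_add_mod _ _).symm⟩
  obtain ⟨c, hc0, hc7, hcb, hc⟩ := exists_foldTurn_mul p n b (foldTurn p m s (b * 2 ^ n))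
  have hc6 : c * 2 ^ n ≤ 6 * 2 ^ n := Nat.mul_le_mul_right _ (by omega)
  have hc1 : 1 * 2 ^ n ≤ c * 2 ^ n := Nat.mul_le_mul_right _ (by omega)
  refine ⟨a + c * 2 ^ n - b * 2 ^ n, by omega, by omega, fun i hi => ?_⟩
  rcases lt_trichotomy (a + i) (b * 2 ^ n) with h | h | h
  · obtain ⟨b', rfl⟩ : ∃ b', b = b' + 1 := ⟨b - 1, by
      rcases b with _ | b
      · simp at h
      · simp⟩
    obtain ⟨c', rfl⟩ : ∃ c', c = c' + 1 := ⟨c - 1, by omega⟩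
    simp only [add_mul, one_mul] at *
    obtain ⟨t, ht⟩ := Nat.exists_eq_add_of_le (show b' * 2 ^ n ≤ a + i by omega)
    have e4 : a + (c' * 2 ^ n + 2 ^ n) - (b' * 2 ^ n + 2 ^ n) + i = c' * 2 ^ n + t := by omega
    rw [e4, ht, foldTurn_block p (n := n) (m := m) (b := b') (r := t) (by omega) _ (by omega)
        (by omega) (by omega),
      foldTurn_block p (n := n) (m := n + 3) (b := c') (r := t) (by omega) _ (by omega)
        (by omega) (by omega)]
    rw [show b' % 2 = c' % 2 by omega]
  · have e4 : a + c * 2 ^ n - b * 2 ^ n + i = c * 2 ^ n := by omega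
    rw [e4, h, hc]
  · obtain ⟨t, ht⟩ := Nat.exists_eq_add_of_lt h
    have e5 : b * 2 ^ n ≤ a + c * 2 ^ n := by omega
    have e4 : a + c * 2 ^ n - b * 2 ^ n + i = c * 2 ^ n + (t + 1) := by omega
    rw [e4, ht, add_assoc, foldTurn_block p (n := n) (m := m) (b := b) (r := t + 1) (by omega) _
        (by omega) (by omega) (by omega),
      foldTurn_block p (n := n) (m := n + 3) (b := c) (r := t + 1) (by omega) _
        (by omega) (by omega) (by omega)]
    rw [hcb]

/-- A long block of a folding word contains all words of level `n`. -/
theorem exists_foldTurn_occurrence (p : ℕ → Bool) {n m : ℕ} (hm : n < m) (s t : Bool) {a l : ℕ}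
    (hl : 3 * 2 ^ n ≤ l) (hal : a + l ≤ 2 ^ m) :
    ∃ h, h + 2 ^ n ≤ l ∧
      ∀ k, 0 < k → k < 2 ^ n → foldTurn p m s (a + (h + k)) = foldTurn p n t k := by
  have hpos : 0 < 2 ^ n := by positivity
  obtain ⟨b, r, hr, hbr⟩ : ∃ b r, r < 2 ^ n ∧ a = b * 2 ^ n + r :=
    ⟨a / 2 ^ n, a % 2 ^ n, Nat.mod_lt _ hpos, by
      rw [mul_comm]; exact (Nat.div_add_mod _ _).symm⟩
  -- Length `3 * 2 ^ n` leaves room for two full level-`n` blocks after `a`, numbered `b + 1` and `b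
  -- + 2`; their types are opposite, so one of them is `t`.
  obtain ⟨c, hc, hc', hct⟩ : ∃ c, b + 1 ≤ c ∧ c ≤ b + 2 ∧
      xor (p n) (decide (c % 2 = 1)) = t := by
    by_cases h : xor (p n) (decide ((b + 1) % 2 = 1)) = t
    · exact ⟨b + 1, le_rfl, by omega, h⟩
    · refine ⟨b + 2, by omega, le_rfl, ?_⟩
      rcases Nat.mod_two_eq_zero_or_one b with hb | hb
      · have h1 : (b + 1) % 2 = 1 := by omega
        have h2 : (b + 2) % 2 = 0 := by omega
        rw [h1] at h; rw [h2]
        revert h; cases p n <;> cases t <;> simp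
      · have h1 : (b + 1) % 2 = 0 := by omega
        have h2 : (b + 2) % 2 = 1 := by omega
        rw [h1] at h; rw [h2]
        revert h; cases p n <;> cases t <;> simp
  have h1 : (b + 1) * 2 ^ n ≤ c * 2 ^ n := Nat.mul_le_mul_right _ hc
  have h2 : c * 2 ^ n ≤ (b + 2) * 2 ^ n := Nat.mul_le_mul_right _ hc'
  rw [add_mul] at h1 h2
  refine ⟨c * 2 ^ n - a, by omega, fun k hk hk' => ?_⟩
  have e : a + (c * 2 ^ n - a + k) = c * 2 ^ n + k := by omega
  rw [e, foldTurn_block p hm s hk hk' (by omega), hct]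

/-! ### Folding sequences and the language of a sequence of bits -/

theorem bar_length (Y : List ℤˣ) : (bar Y).length = Y.length := by simp [bar]

theorem bar_getElem (Y : List ℤˣ) {i : ℕ} (h : i < (bar Y).length) :
    (bar Y)[i] = -Y[Y.length - 1 - i]'(by rw [bar_length] at h; omega) := by
  simp [bar]

theorem IsNFolding.length_add_one {n : ℕ} {Y : List ℤˣ} (h : IsNFolding n Y) :
    Y.length + 1 = 2 ^ n := by
  induction h with
  | zero => rfl
  | succ ε h ih => rw [List.length_append, List.length_cons, bar_length, pow_succ]; omega

theorem IsNFolding.exists_foldTurn {n : ℕ} {Y : List ℤˣ} (h : IsNFolding n Y) :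
    ∃ p s, ∀ i (hi : i < Y.length), Y[i] = foldTurn p n s (i + 1) := by
  induction h with
  | zero => exact ⟨fun _ => false, false, by simp⟩
  | @succ n Y ε h ih =>
    obtain ⟨p, s, hp⟩ := ih
    have hlen := h.length_add_one
    obtain ⟨t, ht⟩ := typeSign_surjective ε
    -- The right half `Y` has type `s`, so the left half `bar Y` has type `!s`, and bit `n` names
    -- the type of the left half.
    refine ⟨Function.update p n (!s), t, fun i hi => ?_⟩
    have hc : ∀ s' k, foldTurn (Function.update p n (!s)) n s' k = foldTurn p n s' k := fun s k =>
      foldTurn_congr (fun i hi => Function.update_of_ne (by omega) _ _) s k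
    have e : 2 ^ (n + 1) = 2 ^ n + 2 ^ n := by ring
    have hb := bar_length Y
    rcases lt_trichotomy (i + 1) (2 ^ n) with h' | h' | h'
    · rw [List.getElem_append_left (by omega), bar_getElem, foldTurn_succ_lt _ _ h',
        Function.update_self, hc, hp, ← foldTurn_not p s (by omega) (by omega)]
      congr 1; omega
    · rw [List.getElem_append_right (by omega)]
      simp only [show i - (bar Y).length = 0 by omega, List.getElem_cons_zero]
      rw [h', foldTurn_succ_mid, ht]
    · rw [List.getElem_append_right (by omega)]
      obtain ⟨j, hj⟩ := Nat.exists_eq_add_of_lt h'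
      simp only [show i - (bar Y).length = j + 1 by omega, List.getElem_cons_succ]
      rw [hj, add_assoc, foldTurn_succ_add _ _ _ (by omega), Function.update_self, hc,
        Bool.not_not, hp]

/-- The finite subwords of `S` are the finite subwords of the words `foldTurn p n s`. -/
structure HasFoldLanguage (p : ℕ → Bool) (S : ℤ → ℤˣ) : Prop where
  occurs : ∀ n s, ∃ h : ℤ, ∀ k : ℕ, 0 < k → k < 2 ^ n → S (h + k) = foldTurn p n s k
  window : ∀ (h : ℤ) (l : ℕ), ∃ n s a, 0 < a ∧ a + l ≤ 2 ^ n ∧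
    ∀ i < l, S (h + (i : ℕ)) = foldTurn p n s (a + i)

theorem HasFoldLanguage.isSubword {p : ℕ → Bool} {S T : ℤ → ℤˣ} (hS : HasFoldLanguage p S)
    (hT : HasFoldLanguage p T) {W : List ℤˣ} (hW : IsSubword W S) : IsSubword W T := by
  obtain ⟨h, hh⟩ := hW
  obtain ⟨n, s, a, ha, hal, hw⟩ := hS.window h W.length
  obtain ⟨h', hT'⟩ := hT.occurs n s
  refine ⟨h' + a, hh.trans (List.map_congr_left fun i hi => ?_)⟩
  rw [List.mem_range] at hi
  rw [hw i hi, ← hT' (a + i) (by omega) (by omega)]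
  push_cast; rw [add_assoc]

theorem HasFoldLanguage.locallyIsomorphic {p : ℕ → Bool} {S T : ℤ → ℤˣ}
    (hS : HasFoldLanguage p S) (hT : HasFoldLanguage p T) : LocallyIsomorphic S T :=
  fun _ => ⟨hS.isSubword hT, hT.isSubword hS⟩

theorem IsCompleteFoldingSequence.exists_window {S : ℤ → ℤˣ} (hS : IsCompleteFoldingSequence S)
    (L : ℕ) : ∃ p m s a, 0 < a ∧ a + 2 * L ≤ 2 ^ m ∧
      ∀ i < 2 * L, S (-L + (i : ℕ)) = foldTurn p m s (a + i) := by
  obtain ⟨m, Y, hY, hsub⟩ := hS ((List.range (2 * L)).map fun k : ℕ => S (-L + (k : ℤ)))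
    ⟨-L, by simp⟩
  obtain ⟨p, s, hp⟩ := hY.exists_foldTurn
  have hlen := hY.length_add_one
  obtain ⟨A, B, rfl⟩ := hsub
  simp only [List.length_append, List.length_map, List.length_range] at hlen
  refine ⟨p, m, s, A.length + 1, by omega, by omega, fun i hi => ?_⟩
  have := hp (A.length + i) (by simp; omega)
  rw [show A.length + 1 + i = A.length + i + 1 by ring, ← this,
    List.getElem_append_left (by simp; omega), List.getElem_append_right (by omega)]
  simp

/-- Compactness: each central window of `S` comes with its own bits `q L`, and `p` is their limit
along an ultrafilter. This suffices because words of level `n` involve only the first `n` bits: a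
long window contains all words of level `n`, and a block of length `l` already occurs in a word of
level `l + 3`. -/
theorem IsCompleteFoldingSequence.exists_hasFoldLanguage {S : ℤ → ℤˣ}
    (hS : IsCompleteFoldingSequence S) : ∃ p, HasFoldLanguage p S := by
  choose q m s a ha hal hq using hS.exists_window
  let U : Ultrafilter ℕ := Filter.hyperfilter ℕ
  have hU : ∀ N : ℕ, ∀ᶠ L in (U : Filter ℕ), N ≤ L := fun N =>
    Nat.hyperfilter_le_atTop (Filter.eventually_ge_atTop N)
  classical
  let p : ℕ → Bool := fun n => decide (∀ᶠ L in (U : Filter ℕ), q L n = true)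
  have hp : ∀ n, ∀ᶠ L in (U : Filter ℕ), ∀ i < n, q L i = p i := by
    intro n
    refine (Filter.eventually_all_finite (Set.finite_lt_nat n)).2 fun i _ => ?_
    by_cases h : ∀ᶠ L in (U : Filter ℕ), q L i = true
    · filter_upwards [h] with L hL
      rw [hL]; exact (decide_eq_true h).symm
    · have h' := Ultrafilter.eventually_not.2 h
      filter_upwards [h'] with L hL
      rw [Bool.not_eq_true] at hL
      rw [hL]; exact (decide_eq_false h).symm
  -- A window of length `2 * L` only fits into a word of large level.
  have hlt : ∀ n L, 2 ^ n ≤ L → n < m L := by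
    intro n L h
    have h1 := hal L
    have h2 := ha L
    by_contra hc
    have : 2 ^ m L ≤ 2 ^ n := Nat.pow_le_pow_right (by omega) (by omega)
    omega
  refine ⟨p, ⟨fun n t => ?_, fun h l => ?_⟩⟩
  · obtain ⟨L, hL, hLp⟩ := ((hU (3 * 2 ^ n)).and (hp n)).exists
    obtain ⟨h, hh, hk⟩ := exists_foldTurn_occurrence (q L) (hlt n L (by omega)) (s L) t
      (a := a L) (l := 2 * L) (by omega) (hal L)
    refine ⟨-L + h, fun k hk0 hkn => ?_⟩
    rw [← foldTurn_congr hLp, ← hk k hk0 hkn, ← hq L (h + k) (by omega)]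
    push_cast; rw [add_assoc]
  · obtain ⟨L, hL, hLp⟩ := ((hU (2 ^ (l + 3) + h.natAbs + l)).and (hp (l + 3))).exists
    have hpos : 0 < 2 ^ (l + 3) := by positivity
    obtain ⟨c, hc⟩ : ∃ c : ℕ, h = -L + c := ⟨(h + L).toNat, by omega⟩
    have hal' := hal L
    obtain ⟨a', ha', hal', hw⟩ := foldTurn_window (q L) (n := l) (hlt (l + 2) L (by
        have : 2 ^ (l + 2) ≤ 2 ^ (l + 3) := Nat.pow_le_pow_right (by omega) (by omega)
        omega)) (s L) (a := a L + c) (l := l) (by have := ha L; omega) Nat.lt_two_pow_self.le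
        (by omega)
    refine ⟨l + 3, false, a', ha', hal', fun i hi => ?_⟩
    rw [← foldTurn_congr hLp, ← hw i hi, add_assoc (a L), ← hq L (c + i) (by omega), hc]
    push_cast; rw [add_assoc]

end Paperfolding

namespace Paperfolding

/-! ### Arcs and their subdivisions -/

/-- The parity sign of a grid point. -/
def paritySign (v : ℤ × ℤ) : ℤˣ := if (v.1 + v.2) % 2 = 0 then 1 else -1

theorem paritySign_even {v : ℤ × ℤ} (h : (v.1 + v.2) % 2 = 0) : paritySign v = 1 := if_pos h

theorem paritySign_odd {v : ℤ × ℤ} (h : (v.1 + v.2) % 2 = 1) : paritySign v = -1 :=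
  if_neg (by omega)

theorem parity_cases (v : ℤ × ℤ) :
    ((v.1 + v.2) % 2 = 0 ∧ paritySign v = 1) ∨ ((v.1 + v.2) % 2 = 1 ∧ paritySign v = -1) := by
  rcases Int.emod_two_eq_zero_or_one (v.1 + v.2) with h | h
  · exact .inl ⟨h, paritySign_even h⟩
  · exact .inr ⟨h, paritySign_odd h⟩

/-- A unit interval of the grid, oriented in such a way that the horizontal ones start at even
points and the vertical ones at odd points. It is given by its initial point and by the sign of
its direction. -/
@[ext]
structure Arc where
  start : ℤ × ℤ
  sign : ℤˣ

namespace Arc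

/-- The direction of an arc. -/
def dir (e : Arc) : ℤ × ℤ :=
  if paritySign e.start = 1 then ((e.sign : ℤ), 0) else (0, (e.sign : ℤ))

/-- The final point of an arc. -/
def target (e : Arc) : ℤ × ℤ := e.start + e.dir

/-- The turn from an arc to an arc which starts where the first one stops. -/
def turn (e f : Arc) : ℤˣ := paritySign e.start * e.sign * f.sign

/-- The type of an arc: `false` for horizontal arcs, `true` for vertical arcs. -/
def isVertical (e : Arc) : Bool := decide (paritySign e.start = -1)

theorem typeSign_isVertical (e : Arc) : typeSign e.isVertical = paritySign e.start := by
  rcases parity_cases e.start with ⟨-, h⟩ | ⟨-, h⟩ <;> simp [isVertical, typeSign, h]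

end Arc

/-- Multiplication by `1 + i`. -/
def expand (v : ℤ × ℤ) : ℤ × ℤ := (v.1 - v.2, v.1 + v.2)

/-- The quarter turn `v ↦ 1 + i v`. -/
def rotV (v : ℤ × ℤ) : ℤ × ℤ := (1 - v.2, v.1)

/-- The half turn `v ↦ 1 + i - v`. -/
def flipV (v : ℤ × ℤ) : ℤ × ℤ := (1 - v.1, 1 - v.2)

/-- The action of `rotV` on arcs. -/
def rotA (e : Arc) : Arc := ⟨rotV e.start, paritySign e.start * e.sign⟩

/-- The action of `flipV` on arcs. -/
def flipA (e : Arc) : Arc := ⟨flipV e.start, -e.sign⟩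

/-- The two arcs which replace the image of an arc under `expand`. -/
def halfArc (j : Bool) (e : Arc) : Arc :=
  if j then ⟨expand e.start + (((paritySign e.start * e.sign : ℤˣ) : ℤ), 0), e.sign⟩
  else ⟨expand e.start, paritySign e.start * e.sign⟩

/-- The position in the fine grid of a vertex of the coarse grid. -/
def place (p q : Bool) (v : ℤ × ℤ) : ℤ × ℤ :=
  (if p then rotV else id) ((if q then flipV else id) (expand v))

/-- The arcs of the fine grid which replace an arc of the coarse grid. -/
def child (p q : Bool) (j : Bool) (e : Arc) : Arc :=
  (if p then rotA else id) ((if q then flipA else id) (halfArc j e))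

/-! ### Endpoints, parities and turns under subdivision -/

theorem paritySign_eq_iff {v w : ℤ × ℤ} :
    paritySign v = paritySign w ↔ (v.1 + v.2) % 2 = (w.1 + w.2) % 2 := by
  rcases parity_cases v with ⟨h, h'⟩ | ⟨h, h'⟩ <;> rcases parity_cases w with ⟨k, k'⟩ | ⟨k, k'⟩ <;>
    simp [h, h', k, k']

theorem paritySign_eq_neg_iff {v w : ℤ × ℤ} :
    paritySign v = -paritySign w ↔ (v.1 + v.2) % 2 ≠ (w.1 + w.2) % 2 := by
  rcases parity_cases v with ⟨h, h'⟩ | ⟨h, h'⟩ <;> rcases parity_cases w with ⟨k, k'⟩ | ⟨k, k'⟩ <;>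
    simp [h, h', k, k']

theorem paritySign_rotV (v : ℤ × ℤ) : paritySign (rotV v) = -paritySign v :=
  paritySign_eq_neg_iff.2 (by simp only [rotV]; omega)

theorem paritySign_flipV (v : ℤ × ℤ) : paritySign (flipV v) = paritySign v :=
  paritySign_eq_iff.2 (by simp only [flipV]; omega)

theorem paritySign_expand (v : ℤ × ℤ) : paritySign (expand v) = 1 :=
  paritySign_even (by simp only [expand]; omega)

theorem paritySign_target (e : Arc) : paritySign e.target = -paritySign e.start := by
  refine paritySign_eq_neg_iff.2 ?_
  rcases Int.units_eq_one_or e.sign with h | h <;> simp only [Arc.target, Arc.dir, h] <;>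
    split_ifs <;> simp <;> omega

theorem target_rotA (e : Arc) : (rotA e).target = rotV e.target := by
  obtain ⟨⟨a, b⟩, s⟩ := e
  have h := paritySign_rotV (a, b)
  simp only [rotA, Arc.target, Arc.dir, h]
  rcases parity_cases (a, b) with ⟨-, h⟩ | ⟨-, h⟩ <;>
    rcases Int.units_eq_one_or s with rfl | rfl <;> simp [h, rotV] <;> ring

theorem target_flipA (e : Arc) : (flipA e).target = flipV e.target := by
  obtain ⟨⟨a, b⟩, s⟩ := e
  have h := paritySign_flipV (a, b)
  simp only [flipA, Arc.target, Arc.dir, h]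
  rcases parity_cases (a, b) with ⟨-, h⟩ | ⟨-, h⟩ <;>
    rcases Int.units_eq_one_or s with rfl | rfl <;> simp [h, flipV] <;> ring

theorem target_halfArc_true (e : Arc) : (halfArc true e).target = expand e.target := by
  obtain ⟨⟨a, b⟩, s⟩ := e
  rcases parity_cases (a, b) with ⟨h', h⟩ | ⟨h', h⟩ <;>
    rcases Int.units_eq_one_or s with rfl | rfl <;>
    (simp only [halfArc, Arc.target, Arc.dir, h]; simp [expand]
     rw [paritySign_odd (by simp; omega)]
     simp; try ring_nf
     try trivial)

theorem start_halfArc_true (e : Arc) : (halfArc true e).start = (halfArc false e).target := by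
  obtain ⟨⟨a, b⟩, s⟩ := e
  simp [halfArc, Arc.target, Arc.dir, paritySign_expand]

theorem start_child_false (p q : Bool) (e : Arc) :
    (child p q false e).start = place p q e.start := by
  cases p <;> cases q <;> rfl

theorem target_child_true (p q : Bool) (e : Arc) :
    (child p q true e).target = place p q e.target := by
  cases p <;> cases q <;> simp [child, place, target_rotA, target_flipA, target_halfArc_true]

theorem start_child_true (p q : Bool) (e : Arc) :
    (child p q true e).start = (child p q false e).target := by
  cases p <;> cases q <;> simp [child, target_rotA, target_flipA] <;>
    simp [rotA, flipA, start_halfArc_true]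

theorem turn_rotA {e f : Arc} (h : paritySign f.start = -paritySign e.start) :
    (rotA e).turn (rotA f) = e.turn f := by
  simp only [Arc.turn, rotA, paritySign_rotV, h]
  rcases Int.units_eq_one_or (paritySign e.start) with h | h <;> simp [h]

theorem turn_flipA (e f : Arc) : (flipA e).turn (flipA f) = e.turn f := by
  simp [Arc.turn, flipA, paritySign_flipV]

theorem paritySign_halfArc (j : Bool) (e : Arc) :
    paritySign (halfArc j e).start = typeSign j := by
  cases j
  · simp [halfArc, paritySign_expand, typeSign]
  · rw [start_halfArc_true, paritySign_target]; simp [halfArc, paritySign_expand, typeSign]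

theorem paritySign_flipA_halfArc (q j : Bool) (e : Arc) :
    paritySign ((if q then flipA else id) (halfArc j e)).start = typeSign j := by
  cases q <;> simp [flipA, paritySign_flipV, paritySign_halfArc]

theorem paritySign_child (p q j : Bool) (e : Arc) :
    paritySign (child p q j e).start = typeSign (xor p j) := by
  cases p <;> simp [child, rotA, paritySign_rotV, paritySign_flipA_halfArc, typeSign_not]

theorem isVertical_child (p q j : Bool) (e : Arc) : (child p q j e).isVertical = xor p j := by
  rw [Arc.isVertical, paritySign_child]; cases p <;> cases j <;> rfl

theorem turn_child (p q i : Bool) {e f : Arc} :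
    (child p q i e).turn (child p q (!i) f) = (halfArc i e).turn (halfArc (!i) f) := by
  have h : paritySign ((if q then flipA else id) (halfArc (!i) f)).start =
      -paritySign ((if q then flipA else id) (halfArc i e)).start := by
    rw [paritySign_flipA_halfArc, paritySign_flipA_halfArc, typeSign_not]
  cases p
  · cases q <;> simp [child, turn_flipA]
  · simp only [child, if_true]
    rw [turn_rotA h]
    cases q <;> simp [turn_flipA]

/-- The two legs have signs `paritySign e.start * e.sign` and `e.sign` before moving, so the
inserted crease depends only on the type of the arc. Types alternate along a path, hence so do the
inserted creases. -/
theorem turn_child_self (p q : Bool) (e : Arc) :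
    (child p q false e).turn (child p q true e) = typeSign e.isVertical := by
  have := turn_child p q false (e := e) (f := e)
  rw [Bool.not_false] at this
  rw [this, e.typeSign_isVertical]
  simp only [halfArc, Arc.turn]
  rcases Int.units_eq_one_or e.sign with h | h <;> simp [h, paritySign_expand]

theorem turn_child_next (p q : Bool) {e f : Arc} (h : e.target = f.start) :
    (child p q true e).turn (child p q false f) = e.turn f := by
  have h1 := paritySign_target e
  have := turn_child p q true (e := e) (f := f)
  rw [Bool.not_true] at this
  rw [this, Arc.turn, paritySign_halfArc]
  simp only [halfArc, Arc.turn, ← h, h1, typeSign]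
  rcases Int.units_eq_one_or e.sign with h | h <;> simp [h]

/-- The `k`-th arc of level `0` in the `n`-fold subdivision of `e`. -/
def descendant (p q : ℕ → Bool) : ℕ → Arc → ℕ → Arc
  | 0, e, _ => e
  | n + 1, e, k =>
    if k < 2 ^ n then descendant p q n (child (p n) (q n) false e) k
    else descendant p q n (child (p n) (q n) true e) (k - 2 ^ n)

theorem descendant_lt (p q : ℕ → Bool) {n k : ℕ} (e : Arc) (h : k < 2 ^ n) :
    descendant p q (n + 1) e k = descendant p q n (child (p n) (q n) false e) k := by
  simp [descendant, h]

theorem descendant_add (p q : ℕ → Bool) (n k : ℕ) (e : Arc) :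
    descendant p q (n + 1) e (2 ^ n + k) = descendant p q n (child (p n) (q n) true e) k := by
  simp [descendant]

theorem descendant_junction (p q : ℕ → Bool) (n : ℕ) {e f : Arc} (h : e.target = f.start) :
    (descendant p q n e (2 ^ n - 1)).target = (descendant p q n f 0).start ∧
      (descendant p q n e (2 ^ n - 1)).turn (descendant p q n f 0) = e.turn f := by
  induction n generalizing e f with
  | zero => exact ⟨h, rfl⟩
  | succ n ih =>
    have hpos : 0 < 2 ^ n := by positivity
    have e1 : 2 ^ (n + 1) - 1 = 2 ^ n + (2 ^ n - 1) := by rw [pow_succ]; omega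
    rw [e1, descendant_add, descendant_lt _ _ _ hpos, ← turn_child_next (p n) (q n) h]
    exact ih (by rw [target_child_true, start_child_false, h])

theorem descendant_step (p q : ℕ → Bool) {n k : ℕ} (e : Arc) (hk : k + 1 < 2 ^ n) :
    (descendant p q n e k).target = (descendant p q n e (k + 1)).start ∧
      (descendant p q n e k).turn (descendant p q n e (k + 1)) =
        foldTurn p n e.isVertical (k + 1) := by
  induction n generalizing e k with
  | zero => simp at hk
  | succ n ih =>
    have e2 : 2 ^ (n + 1) = 2 ^ n + 2 ^ n := by ring
    rcases lt_trichotomy (k + 1) (2 ^ n) with h | h | h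
    · rw [descendant_lt _ _ _ h, descendant_lt _ _ _ (by omega), foldTurn_succ_lt _ _ h]
      have := ih (child (p n) (q n) false e) h
      rwa [isVertical_child, Bool.xor_false] at this
    · have h1 : descendant p q (n + 1) e (k + 1) =
          descendant p q n (child (p n) (q n) true e) 0 := by
        rw [h, ← descendant_add, add_zero]
      have h2 : k = 2 ^ n - 1 := by omega
      rw [h1, descendant_lt _ _ _ (by omega), h, foldTurn_succ_mid, h2,
        ← turn_child_self (p n) (q n)]
      exact descendant_junction p q n (start_child_true _ _ _).symm
    · obtain ⟨j, hj⟩ := Nat.exists_eq_add_of_lt h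
      obtain rfl : k = 2 ^ n + j := by omega
      rw [add_assoc, descendant_add, descendant_add, foldTurn_succ_add _ _ _ (by omega)]
      have := ih (k := j) (child (p n) (q n) true e) (by omega)
      rwa [isVertical_child, Bool.xor_true] at this

/-! ### Ancestors -/

theorem rotA_injective : Function.Injective rotA := by
  rintro ⟨⟨a, b⟩, s⟩ ⟨⟨c, d⟩, t⟩ h
  simp only [rotA, rotV, Arc.mk.injEq, Prod.mk.injEq] at h
  obtain ⟨⟨h1, rfl⟩, h3⟩ := h
  obtain rfl : b = d := by omega
  simpa using h3

theorem flipA_flipA (e : Arc) : flipA (flipA e) = e := by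
  simp [flipA, flipV]

theorem rotA_surjective : Function.Surjective rotA := by
  rintro ⟨⟨a, b⟩, s⟩
  refine ⟨⟨(b, 1 - a), paritySign (b, 1 - a) * s⟩, ?_⟩
  rcases parity_cases (b, 1 - a) with ⟨-, h⟩ | ⟨-, h⟩ <;> simp [rotA, rotV, h]

theorem expand_injective : Function.Injective expand := by
  rintro ⟨a, b⟩ ⟨c, d⟩ h
  simp only [expand, Prod.mk.injEq] at h ⊢
  omega

theorem exists_expand {v : ℤ × ℤ} (h : (v.1 + v.2) % 2 = 0) : ∃ w, expand w = v :=
  ⟨((v.1 + v.2) / 2, (v.2 - v.1) / 2), by ext <;> simp only [expand] <;> omega⟩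

theorem halfArc_injective {i j : Bool} {e f : Arc} (h : halfArc i e = halfArc j f) :
    i = j ∧ e = f := by
  have hij : i = j := by
    have := congrArg (fun a => paritySign a.start) h
    simp only [paritySign_halfArc] at this
    revert this; cases i <;> cases j <;> simp [typeSign]
  subst hij
  refine ⟨rfl, ?_⟩
  cases i
  · simp only [halfArc, Bool.false_eq_true, if_false, Arc.mk.injEq] at h
    obtain ⟨h1, h2⟩ := h
    have h3 := expand_injective h1
    rw [h3] at h2
    exact Arc.ext h3 (mul_left_cancel h2)
  · have h1 : e.target = f.target := expand_injective (by
      rw [← target_halfArc_true, ← target_halfArc_true, h])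
    have h2 : paritySign e.start = paritySign f.start := by
      rw [← neg_inj, ← paritySign_target, ← paritySign_target, h1]
    have h3 : e.sign = f.sign := by
      simpa [halfArc] using congrArg Arc.sign h
    refine Arc.ext ?_ h3
    simpa [Arc.target, Arc.dir, h2, h3] using h1

theorem halfArc_surjective (e : Arc) : ∃ j f, halfArc j f = e := by
  obtain ⟨v, s⟩ := e
  rcases parity_cases v with ⟨h, h'⟩ | ⟨h, h'⟩
  · obtain ⟨w, rfl⟩ := exists_expand h
    refine ⟨false, ⟨w, paritySign w * s⟩, ?_⟩
    rcases Int.units_eq_one_or (paritySign w) with h | h <;> simp [halfArc, h]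
  -- A vertical leg is reached from one of the two horizontal neighbours of its start. These come
  -- from coarse points `w`, `w'` of equal parity, and that parity decides which one is the start of
  -- the parent.
  · obtain ⟨w, hw⟩ := exists_expand (v := v - ((s : ℤ), 0)) (by
      rcases Int.units_eq_one_or s with rfl | rfl <;> simp <;> omega)
    obtain ⟨w', hw'⟩ := exists_expand (v := v + ((s : ℤ), 0)) (by
      rcases Int.units_eq_one_or s with rfl | rfl <;> simp <;> omega)
    rcases parity_cases w with ⟨k, k'⟩ | ⟨k, k'⟩
    · exact ⟨true, ⟨w, s⟩, by simp [halfArc, k', hw]⟩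
    · have k2 : paritySign w' = -1 := by
        refine paritySign_odd ?_
        simp only [expand, Prod.ext_iff, Prod.fst_sub, Prod.snd_sub, Prod.fst_add,
          Prod.snd_add] at hw hw'
        rcases Int.units_eq_one_or s with rfl | rfl <;> simp at hw hw' <;> omega
      refine ⟨true, ⟨w', s⟩, ?_⟩
      simp [halfArc, k2, hw', Prod.ext_iff]

theorem child_bijective (p q : Bool) :
    Function.Bijective fun x : Bool × Arc => child p q x.1 x.2 := by
  have hf : Function.Bijective flipA := ⟨fun a b h => by
    rw [← flipA_flipA a, h, flipA_flipA], fun a => ⟨_, flipA_flipA a⟩⟩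
  have hh : Function.Bijective fun x : Bool × Arc => halfArc x.1 x.2 := by
    refine ⟨fun x y h => ?_, fun e => ?_⟩
    · obtain ⟨h1, h2⟩ := halfArc_injective h
      exact Prod.ext h1 h2
    · obtain ⟨j, f, h⟩ := halfArc_surjective e
      exact ⟨(j, f), h⟩
  have hr : Function.Bijective rotA := ⟨rotA_injective, rotA_surjective⟩
  cases p <;> cases q
  · exact hh
  · exact hf.comp hh
  · exact hr.comp hh
  · exact hr.comp (hf.comp hh)

/-- Each arc is a child of a unique arc, in a unique way. -/
noncomputable def childEquiv (p q : Bool) : Bool × Arc ≃ Arc :=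
  Equiv.ofBijective _ (child_bijective p q)

/-- The arc of the coarse grid of which `e` is a child. -/
noncomputable def parent (p q : Bool) (e : Arc) : Arc := ((childEquiv p q).symm e).2

/-- `true` if `e` is the second child of its parent, `false` if it is the first one. -/
noncomputable def rank (p q : Bool) (e : Arc) : Bool := ((childEquiv p q).symm e).1

theorem child_parent (p q : Bool) (e : Arc) : child p q (rank p q e) (parent p q e) = e :=
  (childEquiv p q).apply_symm_apply e

theorem parent_child (p q j : Bool) (e : Arc) : parent p q (child p q j e) = e :=
  congrArg Prod.snd ((childEquiv p q).symm_apply_apply (j, e))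

theorem rank_child (p q j : Bool) (e : Arc) : rank p q (child p q j e) = j :=
  congrArg Prod.fst ((childEquiv p q).symm_apply_apply (j, e))

/-- The ancestor of level `n` of an arc of level `0`. -/
noncomputable def ancestor (p q : ℕ → Bool) : ℕ → Arc → Arc
  | 0, e => e
  | n + 1, e => parent (p n) (q n) (ancestor p q n e)

/-- The position of an arc among the descendants of its ancestor of level `n`. -/
noncomputable def index (p q : ℕ → Bool) : ℕ → Arc → ℕ
  | 0, _ => 0
  | n + 1, e => index p q n e + if rank (p n) (q n) (ancestor p q n e) then 2 ^ n else 0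

theorem index_lt (p q : ℕ → Bool) (n : ℕ) (e : Arc) : index p q n e < 2 ^ n := by
  induction n with
  | zero => simp [index]
  | succ n ih => rw [index, pow_succ]; split_ifs <;> omega

theorem descendant_index (p q : ℕ → Bool) (n : ℕ) (e : Arc) :
    descendant p q n (ancestor p q n e) (index p q n e) = e := by
  induction n with
  | zero => rfl
  | succ n ih =>
    have h := child_parent (p n) (q n) (ancestor p q n e)
    rw [index, ancestor]
    split_ifs with hr
    · rw [hr] at h
      rw [add_comm (index p q n e), descendant_add, h, ih]
    · rw [Bool.not_eq_true] at hr
      rw [hr] at h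
      rw [add_zero, descendant_lt _ _ _ (index_lt p q n e), h, ih]

theorem ancestor_descendant (p q : ℕ → Bool) {n k : ℕ} (e : Arc) (hk : k < 2 ^ n) :
    ancestor p q n (descendant p q n e k) = e ∧ index p q n (descendant p q n e k) = k := by
  induction n generalizing e k with
  | zero => exact ⟨rfl, by simp [index]; simp at hk; omega⟩
  | succ n ih =>
    rcases lt_or_ge k (2 ^ n) with h | h
    · obtain ⟨h1, h2⟩ := ih (child (p n) (q n) false e) h
      rw [descendant_lt _ _ _ h, ancestor, index, h1, h2, parent_child, rank_child]
      simp
    · obtain ⟨j, rfl⟩ := Nat.exists_eq_add_of_le h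
      obtain ⟨h1, h2⟩ := ih (child (p n) (q n) true e) (k := j) (by rw [pow_succ] at hk; omega)
      rw [descendant_add, ancestor, index, h1, h2, parent_child, rank_child]
      simp [add_comm]

theorem ancestor_congr {p q q' : ℕ → Bool} {n : ℕ} (h : ∀ i < n, q i = q' i) (e : Arc) :
    ancestor p q n e = ancestor p q' n e := by
  induction n with
  | zero => rfl
  | succ n ih => rw [ancestor, ancestor, ih fun i hi => h i (by omega), h n (by omega)]

theorem ancestor_eq_of_le {p q : ℕ → Bool} {n m : ℕ} (h : n ≤ m) {e f : Arc}
    (he : ancestor p q n e = ancestor p q n f) : ancestor p q m e = ancestor p q m f := by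
  induction m, h using Nat.le_induction with
  | base => exact he
  | succ m _ ih => rw [ancestor, ancestor, ih]

end Paperfolding

namespace Paperfolding

/-! ### Merging of arcs -/

theorem paritySign_place (p q : Bool) (v : ℤ × ℤ) : paritySign (place p q v) = typeSign p := by
  cases p <;> cases q <;>
    simp [place, paritySign_rotV, paritySign_flipV, paritySign_expand, typeSign]

theorem rotV_injective : Function.Injective rotV := by
  rintro ⟨a, b⟩ ⟨c, d⟩ h
  simp only [rotV, Prod.mk.injEq] at h ⊢
  omega

theorem flipV_injective : Function.Injective flipV := by
  rintro ⟨a, b⟩ ⟨c, d⟩ h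
  simp only [flipV, Prod.mk.injEq] at h ⊢
  omega

theorem place_injective (p q : Bool) : Function.Injective (place p q) := by
  intro v w h
  cases p <;> cases q
  · exact expand_injective h
  · exact expand_injective (flipV_injective h)
  · exact expand_injective (rotV_injective h)
  · exact expand_injective (flipV_injective (rotV_injective h))

/-- In coarse coordinates the flip is `v ↦ 1 - v`, which exchanges the parities. It thus reverses
the orientation of the coarse grid seen in the plane, and with it the side to which each coarse edge
is bent. -/
theorem paritySign_of_place_eq (p : Bool) {v w : ℤ × ℤ} (h : place p false v = place p true w) :
    paritySign v = -paritySign w := by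
  have h1 : expand v = flipV (expand w) := by
    cases p
    · exact h
    · exact rotV_injective h
  simp only [expand, flipV, Prod.mk.injEq] at h1
  exact paritySign_eq_neg_iff.2 (by omega)

/-- `e` and `f` are opposite sides of a unit square of the grid. -/
def Arc.Opposite (e f : Arc) : Prop :=
  paritySign e.start = paritySign f.start ∧ f.sign = -e.sign ∧
    ∃ t : ℤˣ, f.start = e.target +
      if paritySign e.start = 1 then (0, (t : ℤ)) else ((t : ℤ), 0)

theorem opposite_rotA {e f : Arc} (h : (rotA e).Opposite (rotA f)) : e.Opposite f := by
  obtain ⟨h1, h2, t, h3⟩ := h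
  have hp : ∀ e : Arc, paritySign (rotA e).start = -paritySign e.start := fun e =>
    paritySign_rotV e.start
  rw [hp, hp, neg_inj] at h1
  rw [hp, target_rotA] at h3
  refine ⟨h1, ?_, ?_⟩
  · simp only [rotA, h1] at h2
    rwa [← mul_neg, mul_right_inj] at h2
  · rcases parity_cases e.start with ⟨-, k⟩ | ⟨-, k⟩ <;> rw [k] at h3 ⊢ <;>
      simp [rotA, rotV, Prod.ext_iff] at h3
    · exact ⟨-t, by ext <;> simp <;> omega⟩
    · exact ⟨t, by ext <;> simp <;> omega⟩

theorem opposite_flipA {e f : Arc} (h : (flipA e).Opposite (flipA f)) : e.Opposite f := by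
  obtain ⟨h1, h2, t, h3⟩ := h
  have hp : ∀ e : Arc, paritySign (flipA e).start = paritySign e.start := fun e =>
    paritySign_flipV e.start
  rw [hp, hp] at h1
  rw [hp, target_flipA] at h3
  refine ⟨h1, neg_injective h2, -t, ?_⟩
  rcases parity_cases e.start with ⟨-, k⟩ | ⟨-, k⟩ <;> rw [k] at h3 ⊢ <;>
    simp [flipA, flipV, Prod.ext_iff] at h3 <;> ext <;> simp <;> omega

/-- One diagonal of a fine unit square is a coarse edge, and its two legs are adjacent sides of that
square. So one of two opposite sides has this diagonal as parent, while the parent of the other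
starts (for first legs) or ends (for second legs) at an end of the diagonal. -/
theorem opposite_halfArc {i j : Bool} {e f : Arc} (h : (halfArc i e).Opposite (halfArc j f)) :
    e.target = f.start ∨ f.target = e.start := by
  obtain ⟨h1, h2, t, h3⟩ := h
  obtain rfl : i = j := by
    rw [paritySign_halfArc, paritySign_halfArc] at h1
    revert h1; cases i <;> cases j <;> simp [typeSign]
  rw [paritySign_halfArc] at h3
  obtain ⟨⟨a, b⟩, s⟩ := e
  obtain ⟨⟨c, d⟩, s'⟩ := f
  cases i
  · rw [← start_halfArc_true] at h3
    rcases parity_cases (a, b) with ⟨k1, k⟩ | ⟨k1, k⟩ <;>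
      rcases parity_cases (c, d) with ⟨k1', k'⟩ | ⟨k1', k'⟩ <;>
      rcases Int.units_eq_one_or s with rfl | rfl <;>
      rcases Int.units_eq_one_or s' with rfl | rfl <;>
      rcases Int.units_eq_one_or t with rfl | rfl <;>
      simp [halfArc, typeSign, expand, k, k', Arc.target, Arc.dir, Prod.ext_iff] at * <;> omega
  · rw [target_halfArc_true] at h3
    rcases parity_cases (a, b) with ⟨k1, k⟩ | ⟨k1, k⟩ <;>
      rcases parity_cases (c, d) with ⟨k1', k'⟩ | ⟨k1', k'⟩ <;>
      rcases Int.units_eq_one_or s with rfl | rfl <;>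
      rcases Int.units_eq_one_or s' with rfl | rfl <;>
      rcases Int.units_eq_one_or t with rfl | rfl <;>
      simp [halfArc, typeSign, expand, k, k', Arc.target, Arc.dir, Prod.ext_iff] at * <;> omega

/-- The odd fine points are the centres of the coarse squares, and the arcs bent towards such a
centre are two opposite sides of the square. -/
theorem target_eq_start_halfArc_true {e f : Arc}
    (h : (halfArc false e).target = (halfArc true f).start) : e = f ∨ e.Opposite f := by
  rw [← start_halfArc_true] at h
  obtain ⟨⟨a, b⟩, s⟩ := e
  obtain ⟨⟨c, d⟩, s'⟩ := f
  rcases parity_cases (a, b) with ⟨k1, k⟩ | ⟨k1, k⟩ <;>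
    rcases parity_cases (c, d) with ⟨k1', k'⟩ | ⟨k1', k'⟩ <;>
    rcases Int.units_eq_one_or s with rfl | rfl <;>
    rcases Int.units_eq_one_or s' with rfl | rfl <;>
    simp [halfArc, expand, k, k'] at h k1 k1' <;>
    first
      | omega
      | (refine .inl ?_; ext <;> simp <;> omega)
      | (refine .inr ⟨by rw [k, k'], rfl, 1, ?_⟩; simp [Arc.target, Arc.dir, k]; omega)
      | (refine .inr ⟨by rw [k, k'], rfl, -1, ?_⟩; simp [Arc.target, Arc.dir, k]; omega)

theorem opposite_child {p q i j : Bool} {e f : Arc}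
    (h : (child p q i e).Opposite (child p q j f)) : e.target = f.start ∨ f.target = e.start := by
  cases p <;> cases q
  · exact opposite_halfArc h
  · exact opposite_halfArc (opposite_flipA h)
  · exact opposite_halfArc (opposite_rotA h)
  · exact opposite_halfArc (opposite_flipA (opposite_rotA h))

theorem target_eq_start_child_true {p q : Bool} {e f : Arc}
    (h : (child p q false e).target = (child p q true f).start) : e = f ∨ e.Opposite f := by
  rw [← start_child_true] at h
  apply target_eq_start_halfArc_true
  rw [← start_halfArc_true]
  cases p <;> cases q
  · exact h
  · exact flipV_injective h
  · exact rotV_injective h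
  · exact flipV_injective (rotV_injective h)

theorem target_eq_start_child {p q i j : Bool} {e f : Arc}
    (h : (child p q i e).target = (child p q j f).start) :
    e.target = f.start ∨ e = f ∨ e.Opposite f := by
  have hij : j = !i := by
    have h1 := paritySign_target (child p q i e)
    rw [h, paritySign_child, paritySign_child, ← typeSign_not] at h1
    revert h1; cases i <;> cases j <;> cases p <;> simp [typeSign]
  subst hij
  cases i
  · exact .inr (target_eq_start_child_true h)
  · rw [target_child_true, Bool.not_true, start_child_false] at h
    exact .inl (place_injective _ _ h)

/-- `e` and `f` are equal, or consecutive in some order, or opposite sides of a unit square. -/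
def Arc.Close (e f : Arc) : Prop :=
  e = f ∨ (e.target = f.start ∨ f.target = e.start) ∨ e.Opposite f ∨ f.Opposite e

/-- Being close survives every choice of bits, so two neighbouring arcs stay in one of finitely many
configurations up to any level; only these have to be merged. -/
theorem Arc.Close.parent {e f : Arc} (h : e.Close f) (p q : Bool) :
    (parent p q e).Close (parent p q f) := by
  have he := child_parent p q e
  have hf := child_parent p q f
  rcases h with rfl | (h | h) | h | h
  · exact .inl rfl
  · rw [← he, ← hf] at h
    rcases target_eq_start_child h with h | h | h
    · exact .inr (.inl (.inl h))
    · exact .inl h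
    · exact .inr (.inr (.inl h))
  · rw [← he, ← hf] at h
    rcases target_eq_start_child h with h | h | h
    · exact .inr (.inl (.inr h))
    · exact .inl h.symm
    · exact .inr (.inr (.inr h))
  · rw [← he, ← hf] at h
    exact .inr (.inl (opposite_child h))
  · rw [← he, ← hf] at h
    exact .inr (.inl (opposite_child h).symm)

theorem Arc.Close.ancestor {e f : Arc} (h : e.Close f) (p q : ℕ → Bool) (n : ℕ) :
    (ancestor p q n e).Close (ancestor p q n f) := by
  induction n with
  | zero => exact h
  | succ n ih => exact ih.parent _ _

/-- The arcs `e` and `f` of level `n` have a common ancestor for a convenient choice of the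
flips at the next levels. -/
inductive Mergeable (p : ℕ → Bool) : ℕ → Arc → Arc → Prop
  | refl (n : ℕ) (e : Arc) : Mergeable p n e e
  | step {n : ℕ} {e f : Arc} (b : Bool)
      (h : Mergeable p (n + 1) (parent (p n) b e) (parent (p n) b f)) : Mergeable p n e f

theorem Mergeable.symm {p : ℕ → Bool} {n : ℕ} {e f : Arc} (h : Mergeable p n e f) :
    Mergeable p n f e := by
  induction h with
  | refl n e => exact .refl n e
  | step b _ ih => exact .step b ih

theorem Mergeable.exists_ancestor_eq {p q : ℕ → Bool} {n : ℕ} {e f : Arc}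
    (h : Mergeable p n (ancestor p q n e) (ancestor p q n f)) :
    ∃ q' m, (∀ i < n, q' i = q i) ∧ ancestor p q' m e = ancestor p q' m f := by
  generalize he : ancestor p q n e = e' at h
  generalize hf : ancestor p q n f = f' at h
  induction h generalizing q with
  | refl n e' => exact ⟨q, n, fun _ _ => rfl, he.trans hf.symm⟩
  | @step n e' f' b h ih =>
    have hq : ∀ i < n, Function.update q n b i = q i := fun i hi =>
      Function.update_of_ne (by omega) _ _
    obtain ⟨q', m, h1, h2⟩ := ih (q := Function.update q n b)
      (by rw [ancestor, ancestor_congr hq, he, Function.update_self])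
      (by rw [ancestor, ancestor_congr hq, hf, Function.update_self])
    exact ⟨q', m, fun i hi => (h1 i (by omega)).trans (hq i hi), h2⟩

/-- If two consecutive arcs meet at a point which is not a vertex of the coarse grid, then one of
the flips makes them children of the same arc. -/
theorem exists_parent_eq {p : Bool} {e f : Arc} (h : e.target = f.start)
    (hf : paritySign f.start = -typeSign p) : ∃ b, parent p b e = parent p b f := by
  have key : ∀ e f : Arc, e.target = f.start → paritySign f.start = -1 →
      ∃ (q : Bool) (E : Arc), (if q then flipA else id) (halfArc false E) = e ∧
        (if q then flipA else id) (halfArc true E) = f := by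
    rintro ⟨⟨a, b⟩, s⟩ ⟨⟨c, d⟩, t⟩ h hf
    have he : paritySign (a, b) = 1 := by
      have := paritySign_target ⟨(a, b), s⟩
      rw [h, hf] at this
      exact (neg_injective this).symm
    simp only [Arc.target, Arc.dir, he, if_true, Prod.mk_add_mk, Prod.mk.injEq] at h
    have hab : (a + b) % 2 = 0 := by
      rcases parity_cases (a, b) with h | h
      · exact h.1
      · rw [h.2] at he; simp at he
    -- The candidates for the start of the parent are `w` without the flip and `w'` with it. Their
    -- parities are opposite, so exactly one choice makes the first leg point in the direction of
    -- `e`.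
    obtain ⟨w, hw⟩ := exists_expand (v := (a, b)) hab
    obtain ⟨w', hw'⟩ := exists_expand (v := flipV (a, b)) (by simp only [flipV]; omega)
    have hww : paritySign w' = -paritySign w := by
      refine paritySign_eq_neg_iff.2 ?_
      simp only [expand, flipV, Prod.mk.injEq] at hw hw'
      omega
    by_cases hs : paritySign w * t = s
    · refine ⟨false, ⟨w, t⟩, ?_, ?_⟩
      · simp [halfArc, hw, hs]
      · simp [halfArc, hw, hs]; omega
    · have hs' : paritySign w * t = -s := by
        rcases Int.units_eq_one_or (paritySign w * t) with h | h <;>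
          rcases Int.units_eq_one_or s with h' | h' <;> rw [h, h'] at hs ⊢ <;> simp at hs ⊢
      refine ⟨true, ⟨w', -t⟩, ?_, ?_⟩
      · simp [halfArc, hw', hww, hs', flipA, flipV]
      · simp [halfArc, hw', hww, hs', flipA, flipV]; omega
  suffices H : ∃ b E, child p b false E = e ∧ child p b true E = f by
    obtain ⟨b, E, rfl, rfl⟩ := H
    exact ⟨b, by rw [parent_child, parent_child]⟩
  cases p
  · exact key e f h hf
  · obtain ⟨e, rfl⟩ := rotA_surjective e
    obtain ⟨f, rfl⟩ := rotA_surjective f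
    rw [target_rotA] at h
    obtain ⟨b, E, h1, h2⟩ := key e f (rotV_injective h) (by
      simpa [rotA, paritySign_rotV, typeSign, neg_eq_iff_eq_neg] using hf)
    refine ⟨b, E, ?_, ?_⟩
    · rw [← h1]; rfl
    · rw [← h2]; rfl

/-- If two consecutive arcs meet at a vertex of the coarse grid, then so do their parents, at a
vertex whose parity depends on the flip. -/
theorem exists_parent_target_eq {p : Bool} {e f : Arc} (h : e.target = f.start)
    (hf : paritySign f.start = typeSign p) (ε : ℤˣ) :
    ∃ b, (parent p b e).target = (parent p b f).start ∧ paritySign (parent p b f).start = ε := by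
  have key : ∀ b, (parent p b e).target = (parent p b f).start ∧
      place p b (parent p b f).start = f.start := by
    intro b
    have he' := child_parent p b e
    have hf' := child_parent p b f
    have hr : rank p b f = false := by
      have := paritySign_child p b (rank p b f) (parent p b f)
      rw [hf', hf] at this
      revert this; cases p <;> cases rank _ b f <;> simp [typeSign]
    have hr' : rank p b e = true := by
      have := paritySign_child p b (rank p b e) (parent p b e)
      rw [he', ← neg_inj, ← paritySign_target, h, hf] at this
      revert this; cases p <;> cases rank _ b e <;> simp [typeSign]
    rw [hr] at hf'; rw [hr'] at he'
    have h2 : place p b (parent p b f).start = f.start := by rw [← start_child_false, hf']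
    refine ⟨place_injective p b ?_, h2⟩
    rw [h2, ← target_child_true, he', h]
  have hneg := paritySign_of_place_eq p ((key false).2.trans (key true).2.symm)
  by_cases hε : paritySign (parent p false f).start = ε
  · exact ⟨false, (key false).1, hε⟩
  · refine ⟨true, (key true).1, ?_⟩
    rw [hneg] at hε
    rcases Int.units_eq_one_or (paritySign (parent p true f).start) with h | h <;>
      rcases Int.units_eq_one_or ε with h' | h' <;> rw [h, h'] at hε ⊢ <;> simp at hε

/-- At most two levels are needed. If the meeting point is a coarse vertex, the parents are again
consecutive, and the flip can be chosen so that their meeting point is not a vertex of the next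
grid; one more flip then merges them. -/
theorem mergeable_of_target_eq (p : ℕ → Bool) (n : ℕ) {e f : Arc} (h : e.target = f.start) :
    Mergeable p n e f := by
  have key : ∀ n {e f : Arc}, e.target = f.start → paritySign f.start = -typeSign (p n) →
      Mergeable p n e f := fun n e f h hf => by
    obtain ⟨b, hb⟩ := exists_parent_eq h hf
    exact .step b (hb ▸ .refl _ _)
  by_cases hf : paritySign f.start = -typeSign (p n)
  · exact key n h hf
  · have hf' : paritySign f.start = typeSign (p n) := by
      rcases Int.units_eq_one_or (paritySign f.start) with h | h <;>
        rcases Int.units_eq_one_or (typeSign (p n)) with h' | h' <;> rw [h, h'] at hf ⊢ <;>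
        simp at hf
    obtain ⟨b, h1, h2⟩ := exists_parent_target_eq h hf' (-typeSign (p (n + 1)))
    exact .step b (key (n + 1) h1 h2)

theorem mergeable_of_opposite (p : ℕ → Bool) (n : ℕ) {e f : Arc} (h : e.Opposite f) :
    Mergeable p n e f := by
  rw [← child_parent (p n) false e, ← child_parent (p n) false f] at h
  refine .step false ?_
  rcases opposite_child h with h | h
  · exact mergeable_of_target_eq p _ h
  · exact (mergeable_of_target_eq p _ h).symm

theorem Arc.Close.mergeable {e f : Arc} (h : e.Close f) (p : ℕ → Bool) (n : ℕ) :
    Mergeable p n e f := by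
  rcases h with rfl | (h | h) | h | h
  · exact .refl _ _
  · exact mergeable_of_target_eq p n h
  · exact (mergeable_of_target_eq p n h).symm
  · exact mergeable_of_opposite p n h
  · exact (mergeable_of_opposite p n h).symm

/-! ### Generic flips merge all arcs -/

/-- The choices of flips for which `e` and `f` have a common ancestor are dense. -/
def DenselyMerging (p : ℕ → Bool) (e f : Arc) : Prop :=
  ∀ (q : ℕ → Bool) (n : ℕ), ∃ q' m, (∀ i < n, q' i = q i) ∧
    ancestor p q' m e = ancestor p q' m f

theorem Arc.Close.denselyMerging {e f : Arc} (h : e.Close f) (p : ℕ → Bool) :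
    DenselyMerging p e f :=
  fun q n => ((h.ancestor p q n).mergeable p n).exists_ancestor_eq

theorem DenselyMerging.symm {p : ℕ → Bool} {e f : Arc} (h : DenselyMerging p e f) :
    DenselyMerging p f e := fun q n => by
  obtain ⟨q', m, h1, h2⟩ := h q n
  exact ⟨q', m, h1, h2.symm⟩

theorem DenselyMerging.trans {p : ℕ → Bool} {e f g : Arc} (h : DenselyMerging p e f)
    (h' : DenselyMerging p f g) : DenselyMerging p e g := fun q n => by
  obtain ⟨q₁, m₁, h1, h2⟩ := h q n
  -- Freezing the bits below `m₁` keeps the first merging while the second is arranged.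
  obtain ⟨q₂, m₂, h3, h4⟩ := h' q₁ (max n m₁)
  refine ⟨q₂, max m₁ m₂, fun i hi => (h3 i (by omega)).trans (h1 i hi), ?_⟩
  refine (ancestor_eq_of_le (le_max_left _ _) ?_).trans (ancestor_eq_of_le (le_max_right _ _) h4)
  have : ∀ i < m₁, q₂ i = q₁ i := fun i hi => h3 i (by omega)
  rw [ancestor_congr this, ancestor_congr this, h2]

theorem denselyMerging_of_target_eq (p : ℕ → Bool) {e f : Arc} (h : e.target = f.start) :
    DenselyMerging p e f :=
  Arc.Close.denselyMerging (.inr (.inl (.inl h))) p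

/-- The relation is transitive and holds for consecutive arcs. Arcs with the same start are linked
through an arc ending there, and the grid is connected. -/
theorem denselyMerging (p : ℕ → Bool) (e f : Arc) : DenselyMerging p e f := by
  have htarget : ∀ v s t u, DenselyMerging p ⟨v, t⟩ ⟨(⟨v, s⟩ : Arc).target, u⟩ := by
    intro v s t u
    have hback : ∀ w : ℤ × ℤ, ∃ g : Arc, g.target = w := fun w => by
      rcases parity_cases w with ⟨h, -⟩ | ⟨h, -⟩
      · exact ⟨⟨w - (0, 1), 1⟩, by
          simp [Arc.target, Arc.dir, paritySign_odd (v := w - (0, 1)) (by simp; omega)]⟩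
      · exact ⟨⟨w - (1, 0), 1⟩, by
          simp [Arc.target, Arc.dir, paritySign_even (v := w - (1, 0)) (by simp; omega)]⟩
    obtain ⟨g, hg⟩ := hback v
    exact ((denselyMerging_of_target_eq p (e := g) (f := ⟨v, t⟩) hg).symm.trans
      (denselyMerging_of_target_eq p (f := ⟨v, s⟩) hg)).trans (denselyMerging_of_target_eq p rfl)
  have hx : ∀ a b t u, DenselyMerging p ⟨(a, b), t⟩ ⟨(a + 1, b), u⟩ := by
    intro a b t u
    rcases parity_cases (a, b) with ⟨h, h'⟩ | ⟨h, h'⟩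
    · have := htarget (a, b) 1 t u
      simpa [Arc.target, Arc.dir, h'] using this
    · have := htarget (a + 1, b) (-1) u t
      simp only [Arc.target, Arc.dir, paritySign_even (v := (a + 1, b)) (by simp; omega)] at this
      simpa using this.symm
  have hy : ∀ a b t u, DenselyMerging p ⟨(a, b), t⟩ ⟨(a, b + 1), u⟩ := by
    intro a b t u
    rcases parity_cases (a, b) with ⟨h, h'⟩ | ⟨h, h'⟩
    · have := htarget (a, b + 1) (-1) u t
      simp only [Arc.target, Arc.dir, paritySign_odd (v := (a, b + 1)) (by simp; omega)] at this
      simpa using this.symm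
    · have := htarget (a, b) 1 t u
      simpa [Arc.target, Arc.dir, h'] using this
  have h0 : ∀ b : ℤ, DenselyMerging p ⟨(0, 0), 1⟩ ⟨(0, b), 1⟩ := fun b => by
    induction b using Int.induction_on with
    | zero => exact Arc.Close.denselyMerging (.inl rfl) p
    | succ b ih => exact ih.trans (hy _ _ _ _)
    | pred b ih => exact ih.trans (by simpa using (hy 0 (-b - 1) 1 1).symm)
  have h1 : ∀ a b : ℤ, DenselyMerging p ⟨(0, 0), 1⟩ ⟨(a, b), 1⟩ := fun a b => by
    induction a using Int.induction_on with
    | zero => exact h0 b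
    | succ a ih => exact ih.trans (hx _ _ _ _)
    | pred a ih => exact ih.trans (by simpa using (hx (-a - 1) b 1 1).symm)
  have h2 : ∀ e : Arc, DenselyMerging p ⟨(0, 0), 1⟩ e := fun ⟨(a, b), s⟩ =>
    (h1 (a + 1) b).trans (hx a b s 1).symm
  exact (h2 e).symm.trans (h2 f)

instance : Countable Arc :=
  Function.Injective.countable (f := fun e : Arc => (e.start, e.sign)) fun e f h => by
    simp only [Prod.mk.injEq] at h
    exact Arc.ext h.1 h.2

theorem exists_forall_ancestor_eq (p : ℕ → Bool) :
    ∃ q : ℕ → Bool, ∀ e f, ∃ n, ancestor p q n e = ancestor p q n f := by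
  have hd : Dense (⋂ x : Arc × Arc, {q : ℕ → Bool | ∃ n,
      ancestor p q n x.1 = ancestor p q n x.2}) := by
    refine dense_iInter_of_isOpen (fun x => ?_) fun x => ?_
    -- Open, since the ancestors of level `n` depend on the first `n` bits only; dense, by
    -- `denselyMerging`.
    · rw [isOpen_pi_iff]
      rintro q ⟨n, hn⟩
      refine ⟨Finset.range n, fun i => {q i}, fun i _ => ⟨isOpen_discrete _, rfl⟩, ?_⟩
      intro q' hq'
      have : ∀ i < n, q' i = q i := fun i hi => hq' i (by simpa using hi)
      exact ⟨n, by rw [ancestor_congr this, ancestor_congr this, hn]⟩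
    · rw [dense_iff_inter_open]
      rintro U hU ⟨q, hq⟩
      obtain ⟨I, u, hu, hIU⟩ := isOpen_pi_iff.1 hU q hq
      obtain ⟨q', m, h1, h2⟩ := denselyMerging p x.1 x.2 q (I.sup id + 1)
      refine ⟨q', hIU fun i hi => ?_, m, h2⟩
      rw [h1 i (Nat.lt_succ_of_le (Finset.le_sup (f := id) hi))]
      exact (hu i hi).2
  obtain ⟨q, hq⟩ := hd.nonempty
  exact ⟨q, fun e f => Set.mem_iInter.1 hq (e, f)⟩

end Paperfolding

namespace Paperfolding

/-! ### Enumeration of the arcs -/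

theorem rank_eq (p q : Bool) (e : Arc) : rank p q e = xor p e.isVertical := by
  conv_rhs => rw [← child_parent p q e, isVertical_child, ← Bool.xor_assoc, Bool.xor_self,
    Bool.false_xor]

/-- If all arcs have common ancestors, then no point is a vertex of the grids of all levels. -/
theorem not_forall_eq_place {p q : ℕ → Bool}
    (hM : ∀ e f, ∃ n, ancestor p q n e = ancestor p q n f) (V : ℕ → ℤ × ℤ) :
    ¬ ∀ n, V n = place (p n) (q n) (V (n + 1)) := by
  intro hV
  have key : ∀ s n, (ancestor p q n ⟨V 0, s⟩).start = V n ∧ index p q n ⟨V 0, s⟩ = 0 := by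
    intro s n
    induction n with
    | zero => exact ⟨rfl, rfl⟩
    | succ n ih =>
      obtain ⟨h1, h2⟩ := ih
      have hr : rank (p n) (q n) (ancestor p q n ⟨V 0, s⟩) = false := by
        rw [rank_eq, Arc.isVertical, h1, hV, paritySign_place]
        cases p n <;> rfl
      have hc := child_parent (p n) (q n) (ancestor p q n ⟨V 0, s⟩)
      rw [hr] at hc
      refine ⟨place_injective (p n) (q n) ?_, by simp [index, h2, hr]⟩
      rw [ancestor, ← start_child_false, hc, h1, hV]
  -- The two arcs leaving `V 0` keep index `0` at all levels, and an arc is determined by its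
  -- ancestor and its index: merging would make them equal.
  obtain ⟨n, hn⟩ := hM ⟨V 0, 1⟩ ⟨V 0, -1⟩
  have h1 := descendant_index p q n ⟨V 0, 1⟩
  have h2 := descendant_index p q n ⟨V 0, -1⟩
  rw [hn, (key 1 n).2] at h1
  rw [(key (-1) n).2, h1] at h2
  simp [Arc.ext_iff] at h2

/-- This provides a predecessor: if the index stayed `0`, all ancestors would be first children and
their starts would be one point surviving at all levels. `exists_index_add_one_lt` is the same
argument at the other end. -/
theorem exists_index_pos {p q : ℕ → Bool}
    (hM : ∀ e f, ∃ n, ancestor p q n e = ancestor p q n f) (e : Arc) :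
    ∃ n, 0 < index p q n e := by
  by_contra! h
  refine not_forall_eq_place hM (fun n => (ancestor p q n e).start) fun n => ?_
  have hr : rank (p n) (q n) (ancestor p q n e) = false := by
    have := h (n + 1)
    rw [index] at this
    by_contra hc
    rw [Bool.not_eq_false] at hc
    have hpos : 0 < 2 ^ n := by positivity
    simp [hc] at this
  have hc := child_parent (p n) (q n) (ancestor p q n e)
  rw [hr] at hc
  rw [ancestor, ← start_child_false, hc]

theorem exists_index_add_one_lt {p q : ℕ → Bool}
    (hM : ∀ e f, ∃ n, ancestor p q n e = ancestor p q n f) (e : Arc) :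
    ∃ n, index p q n e + 1 < 2 ^ n := by
  by_contra! h
  refine not_forall_eq_place hM (fun n => (ancestor p q n e).target) fun n => ?_
  have hr : rank (p n) (q n) (ancestor p q n e) = true := by
    have := h (n + 1)
    have h2 := index_lt p q n e
    rw [index, pow_succ] at this
    by_contra hc
    rw [if_neg hc] at this
    have := Nat.one_le_two_pow (n := n)
    omega
  have hc := child_parent (p n) (q n) (ancestor p q n e)
  rw [hr] at hc
  rw [ancestor, ← target_child_true, hc]

theorem index_sub_index {p q : ℕ → Bool} {n m : ℕ} (h : n ≤ m) {e f : Arc}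
    (he : ancestor p q n e = ancestor p q n f) :
    (index p q m e : ℤ) - index p q m f = index p q n e - index p q n f := by
  induction m, h using Nat.le_induction with
  | base => rfl
  | succ m hm ih =>
    rw [index, index, ancestor_eq_of_le hm he]
    push_cast
    linarith

/-- If all arcs have common ancestors, then the subdivision of these ancestors enumerates all the
arcs by the integers. -/
theorem exists_enumeration {p q : ℕ → Bool}
    (hM : ∀ e f, ∃ n, ancestor p q n e = ancestor p q n f) :
    ∃ A : ℤ ≃ Arc, ∀ i j n, ancestor p q n (A i) = ancestor p q n (A j) →
      (index p q n (A i) : ℤ) - index p q n (A j) = i - j := by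
  let e₀ : Arc := ⟨(0, 0), 1⟩
  choose N hN using fun e => hM e e₀
  -- The signed position relative to `e₀`; by `index_sub_index` it does not depend on the level at
  -- which the two arcs have merged.
  let ι : Arc → ℤ := fun e => (index p q (N e) e : ℤ) - index p q (N e) e₀
  have hι : ∀ n e, ancestor p q n e = ancestor p q n e₀ →
      ι e = (index p q n e : ℤ) - index p q n e₀ := by
    intro n e h
    rcases le_total n (N e) with hn | hn
    · exact index_sub_index hn h
    · exact (index_sub_index hn (hN e)).symm
  have hsub : ∀ e f n, ancestor p q n e = ancestor p q n f →
      (index p q n e : ℤ) - index p q n f = ι e - ι f := by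
    intro e f n h
    have he := ancestor_eq_of_le (le_max_right n (N f)) (hN f)
    have hef := ancestor_eq_of_le (le_max_left n (N f)) h
    rw [hι _ f he, hι _ e (hef.trans he), ← index_sub_index (le_max_left n (N f)) h]
    ring
  have hinj : Function.Injective ι := by
    intro e f h
    obtain ⟨n, hn⟩ := hM e f
    have := hsub e f n hn
    rw [h, sub_self] at this
    have hi : index p q n e = index p q n f := by omega
    rw [← descendant_index p q n e, hn, hi, descendant_index]
  have hdesc : ∀ n e k, k < 2 ^ n →
      ι (descendant p q n (ancestor p q n e) k) = ι e + k - index p q n e := by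
    intro n e k hk
    obtain ⟨h1, h2⟩ := ancestor_descendant p q (ancestor p q n e) hk
    have := hsub _ _ n h1
    rw [h2] at this
    linarith
  have hsucc : ∀ e, ∃ f, ι f = ι e + 1 := by
    intro e
    obtain ⟨n, hn⟩ := exists_index_add_one_lt hM e
    exact ⟨_, (hdesc n e _ hn).trans (by push_cast; ring)⟩
  have hpred : ∀ e, ∃ f, ι f = ι e - 1 := by
    intro e
    obtain ⟨n, hn⟩ := exists_index_pos hM e
    refine ⟨_, (hdesc n e (index p q n e - 1) (by have := index_lt p q n e; omega)).trans ?_⟩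
    rw [Nat.cast_sub hn]; push_cast; ring
  have hsurj : Function.Surjective ι := by
    intro i
    induction i using Int.induction_on with
    | zero => exact ⟨e₀, by simp [ι]⟩
    | succ i ih =>
      obtain ⟨e, he⟩ := ih
      rw [← he]; exact hsucc e
    | pred i ih =>
      obtain ⟨e, he⟩ := ih
      rw [← he]; exact hpred e
  refine ⟨(Equiv.ofBijective ι ⟨hinj, hsurj⟩).symm, fun i j n h => ?_⟩
  rw [hsub _ _ n h]
  congr 1
  · exact (Equiv.ofBijective ι ⟨hinj, hsurj⟩).apply_symm_apply i
  · exact (Equiv.ofBijective ι ⟨hinj, hsurj⟩).apply_symm_apply j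

/-- The arcs of the plane can be enumerated as a curve without endpoint whose turns have the
same finite subwords as the folding words prescribed by `p`. -/
theorem exists_curve (p : ℕ → Bool) :
    ∃ A : ℤ ≃ Arc, (∀ i, (A i).target = (A (i + 1)).start) ∧
      HasFoldLanguage p fun i => (A i).turn (A (i + 1)) := by
  obtain ⟨q, hM⟩ := exists_forall_ancestor_eq p
  obtain ⟨A, hA⟩ := exists_enumeration hM
  have hadd : ∀ n i k, index p q n (A i) + k < 2 ^ n →
      A (i + (k : ℕ)) = descendant p q n (ancestor p q n (A i)) (index p q n (A i) + k) := by
    intro n i k hk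
    obtain ⟨j, hj⟩ := A.surjective
      (descendant p q n (ancestor p q n (A i)) (index p q n (A i) + k))
    obtain ⟨h1, h2⟩ := ancestor_descendant p q (ancestor p q n (A i)) hk
    rw [← hj] at h1 h2
    have := hA j i n h1
    rw [h2] at this
    rw [← hj]
    congr 1
    push_cast at this
    linarith
  have hstep : ∀ n i k, index p q n (A i) + k + 1 < 2 ^ n →
      (A (i + (k : ℕ))).target = (A (i + (k : ℕ) + 1)).start ∧
        (A (i + (k : ℕ))).turn (A (i + (k : ℕ) + 1)) =
          foldTurn p n (ancestor p q n (A i)).isVertical (index p q n (A i) + k + 1) := by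
    intro n i k hk
    have e : i + (k : ℤ) + 1 = i + ((k + 1 : ℕ) : ℤ) := by push_cast; ring
    rw [e, hadd n i k (by omega), hadd n i (k + 1) (by omega), ← add_assoc]
    exact descendant_step p q _ hk
  refine ⟨A, fun i => ?_, ⟨fun n s => ?_, fun h l => ?_⟩⟩
  · obtain ⟨n, hn⟩ := exists_index_add_one_lt hM (A i)
    simpa using (hstep n i 0 hn).1
  · obtain ⟨F, hF⟩ : ∃ F : Arc, F.isVertical = s := by
      cases s
      · exact ⟨⟨(0, 0), 1⟩, rfl⟩
      · exact ⟨⟨(1, 0), 1⟩, rfl⟩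
    obtain ⟨i, hi⟩ := A.surjective (descendant p q n F 0)
    obtain ⟨h1, h2⟩ := ancestor_descendant p q F (n := n) (k := 0) (by positivity)
    rw [← hi] at h1 h2
    -- Crease `k` of the word is the turn from descendant `k - 1` to descendant `k`, hence the shift
    -- by one.
    refine ⟨i - 1, fun k hk hkn => ?_⟩
    obtain ⟨k, rfl⟩ : ∃ k', k = k' + 1 := ⟨k - 1, by omega⟩
    have := (hstep n i k (by omega)).2
    rw [h1, h2, hF, zero_add] at this
    rw [← this]
    have e : i - 1 + ((k + 1 : ℕ) : ℤ) = i + k := by push_cast; ring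
    simp only [e]
  · obtain ⟨n, hn⟩ := hM (A (h + l)) (A h)
    have h1 := hA _ _ n hn
    have h2 := index_lt p q n (A (h + l))
    refine ⟨n, (ancestor p q n (A h)).isVertical, index p q n (A h) + 1, by omega, by omega,
      fun i hi => ?_⟩
    rw [show index p q n (A h) + 1 + i = index p q n (A h) + i + 1 by ring]
    exact (hstep n h i (by omega)).2

end Paperfolding

namespace Paperfolding

/-! ### Supports and carriers of segments -/

theorem GridInterval.mem_toSet_horizontal {x y : ℤ} {P : ℝ × ℝ} :
    P ∈ (⟨.horizontal, x, y⟩ : GridInterval).toSet ↔ P.1 ∈ Set.Icc (x : ℝ) (x + 1) ∧ P.2 = y := by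
  have : (⟨.horizontal, x, y⟩ : GridInterval).toSet =
      (fun t : ℝ => (t, (y : ℝ))) '' segment ℝ (x : ℝ) (x + 1) := by
    rw [Prod.image_mk_segment_left]
    simp [GridInterval.toSet, GridInterval.low, GridInterval.high, toPlane]
  rw [this, segment_eq_Icc (by linarith)]
  obtain ⟨a, b⟩ := P
  simp [eq_comm]

theorem GridInterval.mem_toSet_vertical {x y : ℤ} {P : ℝ × ℝ} :
    P ∈ (⟨.vertical, x, y⟩ : GridInterval).toSet ↔ P.1 = x ∧ P.2 ∈ Set.Icc (y : ℝ) (y + 1) := by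
  have : (⟨.vertical, x, y⟩ : GridInterval).toSet =
      (fun t : ℝ => ((x : ℝ), t)) '' segment ℝ (y : ℝ) (y + 1) := by
    rw [Prod.image_mk_segment_right]
    simp [GridInterval.toSet, GridInterval.low, GridInterval.high, toPlane]
  rw [this, segment_eq_Icc (by linarith)]
  obtain ⟨a, b⟩ := P
  simp [eq_comm, and_comm]

/-- The midpoint of a unit interval lies in no other unit interval. -/
theorem GridInterval.toSet_injective : Function.Injective GridInterval.toSet := by
  have hcast : ∀ m n : ℤ, (m : ℝ) ≤ n + 1 / 2 → (n : ℝ) + 1 / 2 ≤ m + 1 → m = n := by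
    intro m n h1 h2
    have h3 : (m : ℝ) < (n + 1 : ℤ) := by push_cast; linarith
    have h4 : (n : ℝ) < (m + 1 : ℤ) := by push_cast; linarith
    have h3 := Int.cast_lt.1 h3
    have h4 := Int.cast_lt.1 h4
    omega
  have hhalf : ∀ m n : ℤ, (n : ℝ) + 1 / 2 ≠ m := by
    intro m n h
    obtain rfl := hcast m n (by linarith) (by linarith)
    linarith
  rintro ⟨_ | _, x, y⟩ ⟨_ | _, x', y'⟩ h
  · have := (Set.ext_iff.1 h (x + 1 / 2, y)).1
      (GridInterval.mem_toSet_horizontal.2 ⟨⟨by simp, by simp; norm_num⟩, rfl⟩)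
    obtain ⟨⟨h1, h2⟩, h3⟩ := GridInterval.mem_toSet_horizontal.1 this
    obtain rfl := hcast x' x h1 h2
    obtain rfl := Int.cast_injective h3
    rfl
  · have := (Set.ext_iff.1 h (x + 1 / 2, y)).1
      (GridInterval.mem_toSet_horizontal.2 ⟨⟨by simp, by simp; norm_num⟩, rfl⟩)
    exact absurd (GridInterval.mem_toSet_vertical.1 this).1 (hhalf _ _)
  · have := (Set.ext_iff.1 h (x, y + 1 / 2)).1
      (GridInterval.mem_toSet_vertical.2 ⟨rfl, ⟨by simp, by simp; norm_num⟩⟩)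
    exact absurd (GridInterval.mem_toSet_horizontal.1 this).2 (hhalf _ _)
  · have := (Set.ext_iff.1 h (x, y + 1 / 2)).1
      (GridInterval.mem_toSet_vertical.2 ⟨rfl, ⟨by simp, by simp; norm_num⟩⟩)
    obtain ⟨h3, h1, h2⟩ := GridInterval.mem_toSet_vertical.1 this
    obtain rfl := hcast y' y h1 h2
    obtain rfl := Int.cast_injective h3
    rfl

theorem abs_unit_mul (u : ℤˣ) {α : ℝ} (hα : 0 < α) :
    -α ≤ ((u : ℤ) : ℝ) * α ∧ ((u : ℤ) : ℝ) * α ≤ α := by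
  rcases Int.units_eq_one_or u with rfl | rfl <;> simp <;> linarith

namespace CurveSegment

theorem beginning_mem_carrier (α : ℝ) (s : CurveSegment) : s.beginning α ∈ s.carrier α := by
  rw [beginning]
  split_ifs
  · exact .inl (.inl (left_mem_segment ℝ _ _))
  · exact .inr (right_mem_segment ℝ _ _)

theorem ending_mem_carrier (α : ℝ) (s : CurveSegment) : s.ending α ∈ s.carrier α := by
  rw [ending]
  split_ifs
  · exact .inr (right_mem_segment ℝ _ _)
  · exact .inl (.inl (left_mem_segment ℝ _ _))

theorem carrier_subset_of_mem {α : ℝ} {s : CurveSegment} {K : Set (ℝ × ℝ)} (hK : Convex ℝ K)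
    (h1 : s.lowTip α ∈ K) (h2 : s.lowBend α ∈ K) (h3 : s.highBend α ∈ K) (h4 : s.highTip α ∈ K) :
    s.carrier α ⊆ K :=
  Set.union_subset (Set.union_subset (hK.segment_subset h1 h2) (hK.segment_subset h2 h3))
    (hK.segment_subset h3 h4)

theorem carrier_subset_horizontal {α : ℝ} (hα : 0 < α) (hα' : α < 1 / 4) {s : CurveSegment}
    (hs : s.axis = .horizontal) :
    s.carrier α ⊆ Set.Icc ((s.x : ℝ) + α, (s.y : ℝ) - α) (s.x + 1 - α, s.y + α) := by
  obtain ⟨h1, h2⟩ := abs_unit_mul s.ζ hα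
  obtain ⟨h3, h4⟩ := abs_unit_mul s.η hα
  apply carrier_subset_of_mem (convex_Icc _ _) <;>
    simp only [lowTip, lowBend, highBend, highTip, hs, Set.mem_Icc, Prod.mk_le_mk] <;>
    refine ⟨⟨?_, ?_⟩, ?_, ?_⟩ <;> linarith

theorem carrier_subset_vertical {α : ℝ} (hα : 0 < α) (hα' : α < 1 / 4) {s : CurveSegment}
    (hs : s.axis = .vertical) :
    s.carrier α ⊆ Set.Icc ((s.x : ℝ) - α, (s.y : ℝ) + α) (s.x + α, s.y + 1 - α) := by
  obtain ⟨h1, h2⟩ := abs_unit_mul s.ζ hα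
  obtain ⟨h3, h4⟩ := abs_unit_mul s.η hα
  apply carrier_subset_of_mem (convex_Icc _ _) <;>
    simp only [lowTip, lowBend, highBend, highTip, hs, Set.mem_Icc, Prod.mk_le_mk] <;>
    refine ⟨⟨?_, ?_⟩, ?_, ?_⟩ <;> linarith

theorem HasEndpoint.mem_support {s : CurveSegment} {X : ℤ × ℤ} (h : s.HasEndpoint X) :
    toPlane X ∈ s.support := by
  have hl : toPlane s.low ∈ s.support := left_mem_segment ℝ _ _
  have hh : toPlane s.high ∈ s.support := right_mem_segment ℝ _ _
  unfold HasEndpoint initialPoint terminalPoint at h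
  split_ifs at h <;> rcases h with rfl | rfl <;> assumption

end CurveSegment

/-! ### From arcs to segments -/

/-- The unit interval which supports an arc. -/
def Arc.interval (e : Arc) : GridInterval where
  axis := if paritySign e.start = 1 then .horizontal else .vertical
  x := if e.sign = 1 then e.start.1 else e.target.1
  y := if e.sign = 1 then e.start.2 else e.target.2

theorem Arc.interval_injective : Function.Injective Arc.interval := by
  rintro ⟨⟨a, b⟩, s⟩ ⟨⟨c, d⟩, t⟩ h
  rcases parity_cases (a, b) with ⟨k1, k⟩ | ⟨k1, k⟩ <;>
    rcases parity_cases (c, d) with ⟨k1', k'⟩ | ⟨k1', k'⟩ <;>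
    rcases Int.units_eq_one_or s with rfl | rfl <;>
    rcases Int.units_eq_one_or t with rfl | rfl <;>
    simp [Arc.interval, Arc.target, Arc.dir, k, k'] at h k1 k1' ⊢ <;> omega

theorem Arc.interval_surjective : Function.Surjective Arc.interval := by
  rintro ⟨_ | _, x, y⟩
  · rcases parity_cases (x, y) with ⟨h, h'⟩ | ⟨h, -⟩
    · exact ⟨⟨(x, y), 1⟩, by simp [Arc.interval, h']⟩
    · have h' := paritySign_even (v := (x + 1, y)) (by simp at h ⊢; omega)
      exact ⟨⟨(x + 1, y), -1⟩, by simp [Arc.interval, Arc.target, Arc.dir, h']⟩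
  · rcases parity_cases (x, y) with ⟨h, -⟩ | ⟨h, h'⟩
    · have h' := paritySign_odd (v := (x, y + 1)) (by simp at h ⊢; omega)
      exact ⟨⟨(x, y + 1), -1⟩, by simp [Arc.interval, Arc.target, Arc.dir, h']⟩
    · exact ⟨⟨(x, y), 1⟩, by simp [Arc.interval, h']⟩

/-- The segment of curve which follows the arc `e`, where `a` and `b` are the signs of the
preceding and of the following arc. -/
def Arc.segment (e : Arc) (a b : ℤˣ) : CurveSegment where
  toGridInterval := e.interval
  ζ := if e.sign = 1 then -a else b
  η := if e.sign = 1 then b else -a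
  orient := e.sign

theorem Arc.initialPoint_segment (e : Arc) (a b : ℤˣ) : (e.segment a b).initialPoint = e.start := by
  obtain ⟨⟨c, d⟩, s⟩ := e
  rcases parity_cases (c, d) with ⟨-, k⟩ | ⟨-, k⟩ <;>
    rcases Int.units_eq_one_or s with rfl | rfl <;>
    simp [CurveSegment.initialPoint, Arc.segment, Arc.interval, GridInterval.low,
      GridInterval.high, Arc.target, Arc.dir, k]

theorem Arc.terminalPoint_segment (e : Arc) (a b : ℤˣ) :
    (e.segment a b).terminalPoint = e.target := by
  obtain ⟨⟨c, d⟩, s⟩ := e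
  rcases parity_cases (c, d) with ⟨-, k⟩ | ⟨-, k⟩ <;>
    rcases Int.units_eq_one_or s with rfl | rfl <;>
    simp [CurveSegment.terminalPoint, Arc.segment, Arc.interval, GridInterval.low,
      GridInterval.high, Arc.target, Arc.dir, k]

theorem Arc.direction_segment (e : Arc) (a b : ℤˣ) : (e.segment a b).direction = e.dir := by
  rw [CurveSegment.direction, initialPoint_segment, terminalPoint_segment, Arc.target,
    add_sub_cancel_left]

theorem Arc.turn_eq_det {e f : Arc} (h : e.target = f.start) :
    ((e.turn f : ℤˣ) : ℤ) = e.dir.1 * f.dir.2 - e.dir.2 * f.dir.1 := by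
  have hp := paritySign_target e
  rw [h] at hp
  rcases parity_cases e.start with ⟨-, k⟩ | ⟨-, k⟩ <;> simp [Arc.turn, Arc.dir, hp, k]

/-- Each carrier lies in a box of width `2 * α` around its support, shortened by `α` at both ends.
The boxes of two perpendicular edges at a vertex touch in a single corner, which is the common tip.
-/
theorem Arc.consecutive_segment {α : ℝ} (hα : 0 < α) (hα' : α < 1 / 4) {e f : Arc}
    (h : e.target = f.start) (a b : ℤˣ) :
    CurveSegment.Consecutive α (e.segment a f.sign) (f.segment e.sign b) := by
  have hend : (e.segment a f.sign).ending α = (f.segment e.sign b).beginning α := by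
    obtain ⟨⟨x, y⟩, s⟩ := e
    obtain ⟨⟨x', y'⟩, t⟩ := f
    have hp := paritySign_target ⟨(x, y), s⟩
    rw [h] at hp
    rcases parity_cases (x, y) with ⟨-, k⟩ | ⟨-, k⟩ <;>
      rcases Int.units_eq_one_or s with rfl | rfl <;>
      rcases Int.units_eq_one_or t with rfl | rfl <;>
      simp [Arc.target, Arc.dir, k] at h hp <;> obtain ⟨rfl, rfl⟩ := h <;>
      simp [CurveSegment.ending, CurveSegment.beginning, CurveSegment.lowTip,
        CurveSegment.highTip, Arc.segment, Arc.interval, Arc.target, Arc.dir, k, hp] <;>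
      try (first | ring1 | (constructor <;> ring1))
  refine ⟨⟨(e.segment a f.sign).ending α, Set.Subset.antisymm ?_ ?_⟩, hend⟩
  · rintro P ⟨h1, h2⟩
    rw [Set.mem_singleton_iff]
    obtain ⟨⟨x, y⟩, s⟩ := e
    obtain ⟨⟨x', y'⟩, t⟩ := f
    obtain ⟨X, Y⟩ := P
    have hp := paritySign_target ⟨(x, y), s⟩
    rw [h] at hp
    rcases parity_cases (x, y) with ⟨-, k⟩ | ⟨-, k⟩
    · rw [k] at hp
      have h1 := CurveSegment.carrier_subset_horizontal hα hα'
        (by simp [Arc.segment, Arc.interval, k]) h1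
      have h2 := CurveSegment.carrier_subset_vertical hα hα'
        (by simp [Arc.segment, Arc.interval, hp]) h2
      rcases Int.units_eq_one_or s with rfl | rfl <;>
        rcases Int.units_eq_one_or t with rfl | rfl <;>
        simp [Arc.target, Arc.dir, k] at h hp <;> obtain ⟨rfl, rfl⟩ := h <;>
        simp [CurveSegment.ending, CurveSegment.lowTip,
          CurveSegment.highTip, Arc.segment, Arc.interval, Arc.target, Arc.dir, k,
          hp] at h1 h2 ⊢ <;>
        constructor <;> linarith
    · rw [k] at hp
      have h1 := CurveSegment.carrier_subset_vertical hα hα'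
        (by simp [Arc.segment, Arc.interval, k]) h1
      have h2 := CurveSegment.carrier_subset_horizontal hα hα'
        (by simp [Arc.segment, Arc.interval, hp]) h2
      rcases Int.units_eq_one_or s with rfl | rfl <;>
        rcases Int.units_eq_one_or t with rfl | rfl <;>
        simp [Arc.target, Arc.dir, k] at h hp <;> obtain ⟨rfl, rfl⟩ := h <;>
        simp [CurveSegment.ending, CurveSegment.lowTip,
          CurveSegment.highTip, Arc.segment, Arc.interval, Arc.target, Arc.dir, k,
          hp] at h1 h2 ⊢ <;>
        constructor <;> linarith
  · rintro P rfl
    exact ⟨CurveSegment.ending_mem_carrier _ _, hend ▸ CurveSegment.beginning_mem_carrier _ _⟩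

/-- A complete curve whose supports are all the unit intervals of the grid, and such that each
segment starts where the preceding one stops, is a covering of the plane. -/
theorem IsCompleteCurve.isCoveringOfPlane {α : ℝ} {C : ℤ → CurveSegment}
    (hC : IsCompleteCurve α C) (hsurj : ∀ e : GridInterval, ∃ i, (C i).support = e.toSet)
    (hstep : ∀ i, (C i).terminalPoint = (C (i + 1)).initialPoint)
    (hne : ∀ i, (C i).initialPoint ≠ (C i).terminalPoint) :
    IsCoveringOfPlane α (Set.range C) := by
  obtain ⟨hcons, hdist⟩ := hC
  have hneighbour : ∀ i X, (C i).HasEndpoint X →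
      ((C i).terminalPoint = X ∧ (C (i + 1)).initialPoint = X) ∨
        ((C i).initialPoint = X ∧ (C (i - 1)).terminalPoint = X) := by
    rintro i X (h | h)
    · refine .inr ⟨h, ?_⟩
      rw [hstep, sub_add_cancel, h]
    · exact .inl ⟨h, by rw [← hstep, h]⟩
  refine ⟨fun e => ?_, ?_⟩
  · obtain ⟨i, hi⟩ := hsurj e
    refine ⟨C i, ⟨⟨i, rfl⟩, hi⟩, ?_⟩
    rintro _ ⟨⟨j, rfl⟩, hj⟩
    by_contra hc
    exact hdist j i (fun h => hc (by rw [h])) (hj.trans hi.symm)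
  rintro _ ⟨i, rfl⟩ _ ⟨j, rfl⟩ hij hlink X hi hj
  have hlinked : ∀ i, CurveSegment.Linked α (C i) (C (i + 1)) := fun i => .inl (hcons i)
  have hlinked' : ∀ i, CurveSegment.Linked α (C i) (C (i - 1)) := fun i => .inr (by
    have := hcons (i - 1)
    rwa [sub_add_cancel] at this)
  have hij' : i ≠ j := fun h => hij (by rw [h])
  have hj1 : j ≠ i + 1 := fun h => hlink (h ▸ hlinked i)
  have hj2 : j ≠ i - 1 := fun h => hlink (h ▸ hlinked' i)
  have hnodup : ∀ i' j', i ≠ i' → i ≠ j' → i' ≠ j → i' ≠ j' → j ≠ j' →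
      [(C i).support, (C i').support, (C j).support, (C j').support].Nodup := by
    intro i' j' h1 h2 h3 h4 h5
    simp [hdist _ _ h1, hdist _ _ h2, hdist _ _ h3, hdist _ _ h4, hdist _ _ h5, hdist _ _ hij']
  -- Excludes that the two segments are completed by the same neighbour: it would start and stop at
  -- `X`.
  have hmid : ∀ k, (C k).terminalPoint = X → (C (k + 1 + 1)).initialPoint = X → False := by
    intro k h1 h2
    exact hne (k + 1) (by rw [← hstep, h1, hstep, h2])
  rcases hneighbour i X hi with ⟨a1, a2⟩ | ⟨a1, a2⟩ <;>
    rcases hneighbour j X hj with ⟨b1, b2⟩ | ⟨b1, b2⟩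
  · exact ⟨_, ⟨i + 1, rfl⟩, _, ⟨j + 1, rfl⟩, hlinked i, hlinked j,
      hnodup _ _ (by omega) (by omega) (by omega) (by omega) (by omega), hi.mem_support,
      CurveSegment.HasEndpoint.mem_support (.inl a2), hj.mem_support,
      CurveSegment.HasEndpoint.mem_support (.inl b2)⟩
  · have hk : i + 1 ≠ j - 1 := fun h => hmid i a1 (by
      rwa [show i + 1 + 1 = j by omega])
    exact ⟨_, ⟨i + 1, rfl⟩, _, ⟨j - 1, rfl⟩, hlinked i, hlinked' j,
      hnodup _ _ (by omega) (by omega) (by omega) (by omega) (by omega), hi.mem_support,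
      CurveSegment.HasEndpoint.mem_support (.inl a2), hj.mem_support,
      CurveSegment.HasEndpoint.mem_support (.inr b2)⟩
  · have hk : j + 1 ≠ i - 1 := fun h => hmid j b1 (by
      rwa [show j + 1 + 1 = i by omega])
    exact ⟨_, ⟨i - 1, rfl⟩, _, ⟨j + 1, rfl⟩, hlinked' i, hlinked j,
      hnodup _ _ (by omega) (by omega) (by omega) (by omega) (by omega), hi.mem_support,
      CurveSegment.HasEndpoint.mem_support (.inr a2), hj.mem_support,
      CurveSegment.HasEndpoint.mem_support (.inl b2)⟩
  · exact ⟨_, ⟨i - 1, rfl⟩, _, ⟨j - 1, rfl⟩, hlinked' i, hlinked' j,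
      hnodup _ _ (by omega) (by omega) (by omega) (by omega) (by omega), hi.mem_support,
      CurveSegment.HasEndpoint.mem_support (.inr a2), hj.mem_support,
      CurveSegment.HasEndpoint.mem_support (.inr b2)⟩

end Paperfolding

theorem theorem3p7 (α : ℝ) (hα : 0 < α) (hα' : α < 1 / 4)
    (S : ℤ → ℤˣ) (hS : Paperfolding.IsCompleteFoldingSequence S) :
    ∃ (C : ℤ → Paperfolding.CurveSegment) (T : ℤ → ℤˣ),
      Paperfolding.IsCompleteFoldingCurve α C ∧
      Paperfolding.IsAssociated C T ∧
      Paperfolding.LocallyIsomorphic T S ∧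
      Paperfolding.IsCoveringOfPlane α (Set.range C) := by
  obtain ⟨p, hp⟩ := hS.exists_hasFoldLanguage
  obtain ⟨A, hA, hT⟩ := Paperfolding.exists_curve p
  have hloc := hT.locallyIsomorphic hp
  let C : ℤ → Paperfolding.CurveSegment := fun i =>
    (A i).segment (A (i - 1)).sign (A (i + 1)).sign
  have hassoc : Paperfolding.IsAssociated C fun i => (A i).turn (A (i + 1)) := fun i => by
    simp only [C, Paperfolding.Arc.direction_segment]
    exact Paperfolding.Arc.turn_eq_det (hA i)
  have hcurve : Paperfolding.IsCompleteCurve α C := by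
    refine ⟨fun i => ?_, fun i j hij h => hij ?_⟩
    · simpa [C] using Paperfolding.Arc.consecutive_segment hα hα' (hA i) (A (i - 1)).sign
        (A (i + 1 + 1)).sign
    · exact A.injective
        (Paperfolding.Arc.interval_injective (Paperfolding.GridInterval.toSet_injective h))
  -- Being a complete folding sequence depends only on the finite subwords, so it passes from `S` to
  -- the turns of the curve.
  refine ⟨C, _, ⟨hcurve, _, fun W hW => hS W ((hloc W).1 hW), hassoc⟩, hassoc, hloc,
    hcurve.isCoveringOfPlane (fun e => ?_) (fun i => ?_) (fun i => ?_)⟩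
  · obtain ⟨a, rfl⟩ := Paperfolding.Arc.interval_surjective e
    obtain ⟨i, rfl⟩ := A.surjective a
    exact ⟨i, rfl⟩
  · simp only [C, Paperfolding.Arc.initialPoint_segment, Paperfolding.Arc.terminalPoint_segment]
    exact hA i
  · simp only [C, Paperfolding.Arc.initialPoint_segment, Paperfolding.Arc.terminalPoint_segment]
    intro h
    have := Paperfolding.paritySign_target (A i)
    rw [← h] at this
    rcases Int.units_eq_one_or (Paperfolding.paritySign (A i).start) with h | h <;>
      simp [h] at this
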